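/- Let $X$ be a locally compact Polish space with Borel $\sigma$-algebra $\mathcal B(X)$, let $\mathcal B_0(X)$ be the family of Borel sets with compact closure, and write $\mathbb R_+=(0,\infty)$. Let $\mathbb M(X)$ be the set of Radon measures on $X$ (Borel measures finite on compact sets) with the vague topology (the weakest topology making $\eta\mapsto\int_X f\,d\eta$ continuous for every continuous compactly supported $f:X\to\mathbb R$) and its Borel $\sigma$-algebra, and let $\mathbb K(X)\subset\mathbb M(X)$ be the set of discrete Radon measures $\eta=\sum_i s_i\delta_{x_i}$ (at most countably many distinct atoms $x_i\in X$, possibly none, and weights $s_i>0$). For $\eta\in\mathbb K(X)$ write $s_x:=\eta(\{x\})$. Let $C_0(X\to\mathbb R_+)$ be the group, under pointwise multiplication, of continuous functions $\theta:X\to\mathbb R_+$ which equal $1$ outside a compact set; it acts on $\mathbb M(X)$ by letting $\theta\eta$ be the measure with density $\theta$ with respect to $\eta$. For a measure $\mu$ on $\mathbb M(X)$ let $\mu^\theta$ be its pushforward under $\eta\mapsto\theta\eta$, and write $\theta^{-1}(x)=1/\theta(x)$. A completely random measure is a probability measure $\mu$ on $\mathbb M(X)$ under which $\eta(A_1),\dots,\eta(A_n)$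 are independent whenever $A_1,\dots,A_n\in\mathcal B_0(X)$ are pairwise disjoint. For a measure $m$ on $X\times\mathbb R_+$, a completely random discrete measure with Lévy measure $m$ is a completely random measure $\mu_m$ with $\mu_m(\mathbb K(X))=1$ and $$\int_{\mathbb K(X)}e^{i\int_X f\,d\eta}\,d\mu_m(\eta)=\exp\left[\int_{X\times\mathbb R_+}\left(e^{isf(x)}-1\right)dm(x,s)\right]$$ for all continuous compactly supported $f:X\to\mathbb R$. **Theorem 3.1.** Let $\sigma$ be a Radon measure on $X$ with $\sigma(\{x\})=0$ for every $x\in X$, let $l:X\times\mathbb R_+\to[0,\infty)$ be measurable, and let $dm(x,s)=\frac{l(x,s)}{s}\,d\sigma(x)\,ds$. Suppose that for each $x\in X$ either $l(x,s)>0$ for all $s\in\mathbb R_+$ or $l(x,s)=0$ for all $s\in\mathbb R_+$; let $Y$ be the set of those $x$ for which the first alternative holds, and let $\mathcal B_0(Y)$ be the family of all $A\in\mathcal B_0(X)$ with $A\subset Y$. Assume that $$\int_{A\times\mathbb R_+}l(x,s)\min\{s^{-1},1\}\,d\sigma(x)\,ds<\infty\quad\text{for all }A\in\mathcal B_0(Y),$$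 and that for each integer $n\ge1$ there exists $\epsilon>0$ such that, for each $A\in\mathcal B_0(Y)$, $$\int_A\left[\sup_{r\in[\frac1n,n]}\int_{(0,\epsilon)}\frac{|l(x,rs)-l(x,s)|}{s}\,ds\right]d\sigma(x)<\infty.$$ Then there is a unique completely random discrete measure $\mu_m$ with Lévy measure $m$, and it is quasi-invariant under $C_0(X\to\mathbb R_+)$: each $\theta\in C_0(X\to\mathbb R_+)$ maps $\mathbb K(X)$ into itself, and $\mu_m^\theta$ is equivalent to $\mu_m$. Moreover, for each $\theta\in C_0(X\to\mathbb R_+)$: * the function $x\mapsto\log\left(\frac{l(x,\theta^{-1}(x)s_x)}{l(x,s_x)}\right)s_x^{-1}$ belongs to $L^1(Y,\eta)$ for $\mu_m$-a.a. $\eta\in\mathbb K(X)$; * the function $(x,s)\mapsto\frac{l(x,s)-l(x,\theta^{-1}(x)s)}{s}$ is integrable on $Y\times\mathbb R_+$ with respect to $d\sigma(x)\,ds$; * for $\mu_m$-a.a. $\eta\in\mathbb K(X)$, $$\frac{d\mu_m^\theta}{d\mu_m}(\eta)=\exp\left[\int_Y\log\left(\frac{l(x,\theta^{-1}(x)s_x)}{l(x,s_x)}\right)s_x^{-1}\,d\eta(x)+\int_Y\int_{\mathbb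 R_+}\frac{l(x,s)-l(x,\theta^{-1}(x)s)}{s}\,ds\,d\sigma(x)\right].$$ -/

import Mathlib

open MeasureTheory ProbabilityTheory Set
open scoped CompactlySupported ENNReal

noncomputable section

/-- The set of Radon measures on `X`: Borel measures that are finite on compact sets. -/
def RadonMeasure (X : Type*) [TopologicalSpace X] [MeasurableSpace X] : Type _ :=
  {η : Measure X // ∀ K : Set X, IsCompact K → η K < ∞}

/-- The vague topology: the weakest topology making `η ↦ ∫ f dη` continuous for every continuous
real function `f` with compact support. -/
instance RadonMeasure.vagueTopology (X : Type*) [TopologicalSpace X] [MeasurableSpace X] :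
    TopologicalSpace (RadonMeasure X) :=
  ⨅ f : C_c(X, ℝ), TopologicalSpace.induced (fun η : RadonMeasure X => ∫ x, f x ∂η.1) inferInstance

/-- The Borel σ-algebra of the vague topology. -/
instance RadonMeasure.measurableSpace (X : Type*) [TopologicalSpace X] [MeasurableSpace X] :
    MeasurableSpace (RadonMeasure X) := borel (RadonMeasure X)

instance RadonMeasure.borelSpace (X : Type*) [TopologicalSpace X] [MeasurableSpace X] :
    BorelSpace (RadonMeasure X) := ⟨rfl⟩

/-- The set of discrete Radon measures `η = ∑ s_x δ_x`, where `x` runs over an at most countable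
set `T` (possibly empty) of distinct atoms and `s_x > 0`. -/
def discreteRadon (X : Type*) [TopologicalSpace X] [MeasurableSpace X] : Set (RadonMeasure X) :=
  {η | ∃ (T : Set X) (s : X → ℝ), T.Countable ∧ (∀ x ∈ T, 0 < s x) ∧
    η.1 = Measure.sum fun x : T => ENNReal.ofReal (s x) • Measure.dirac (x : X)}

/-- The weight `s_x = η({x})` of `η` at the point `x`. -/
def RadonMeasure.weight {X : Type*} [TopologicalSpace X] [MeasurableSpace X]
    (η : RadonMeasure X) (x : X) : ℝ := η.1.real {x}

/-- The current group: continuous functions with values in `(0, ∞)` which are equal to `1` outside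
a compact set, under pointwise multiplication. -/
def currentGroup (X : Type*) [TopologicalSpace X] : Subgroup (X → {r : ℝ // 0 < r}) where
  carrier := {θ | Continuous θ ∧ ∃ K : Set X, IsCompact K ∧ ∀ x, x ∉ K → θ x = 1}
  one_mem' := ⟨continuous_const, ∅, isCompact_empty, fun _ _ => rfl⟩
  mul_mem' := by
    rintro a b ⟨hac, K, hK, ha⟩ ⟨hbc, L, hL, hb⟩
    refine ⟨?_, K ∪ L, hK.union hL, fun x hx => ?_⟩
    · refine continuous_induced_rng.2 ?_
      exact (continuous_subtype_val.comp hac).mul (continuous_subtype_val.comp hbc)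
    rw [mem_union, not_or] at hx
    rw [Pi.mul_apply, ha x hx.1, hb x hx.2, one_mul]
  inv_mem' := by
    rintro a ⟨hac, K, hK, ha⟩
    refine ⟨?_, K, hK, fun x hx => ?_⟩
    · refine continuous_induced_rng.2 ?_
      exact (continuous_subtype_val.comp hac).inv₀ fun x => (a x).2.ne'
    · rw [Pi.inv_apply, ha x hx, inv_one]

/-- The value `θ(x)` of a current, as a real number. -/
def currentVal {X : Type*} [TopologicalSpace X] (θ : currentGroup X) (x : X) : ℝ := (θ.1 x : ℝ)

theorem continuous_currentVal {X : Type*} [TopologicalSpace X] (θ : currentGroup X) :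
    Continuous (currentVal θ) := continuous_subtype_val.comp θ.2.1

/-- The action of the current group on Radon measures: `θη` has density `θ` with respect to `η`. -/
instance currentSMul (X : Type*) [TopologicalSpace X] [T2Space X] [MeasurableSpace X]
    [BorelSpace X] : SMul (currentGroup X) (RadonMeasure X) where
  smul θ η := ⟨η.1.withDensity fun x => ENNReal.ofReal (currentVal θ x), by
    intro K hK
    obtain ⟨C, hC⟩ := (hK.image (continuous_currentVal θ)).bddAbove
    rw [withDensity_apply _ hK.measurableSet]
    have hle : ∫⁻ x in K, ENNReal.ofReal (currentVal θ x) ∂η.1 ≤ ∫⁻ _ in K, ENNReal.ofReal C ∂η.1 :=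
      setLIntegral_mono measurable_const fun x hx =>
        ENNReal.ofReal_le_ofReal (hC (mem_image_of_mem _ hx))
    refine hle.trans_lt ?_
    rw [setLIntegral_const]
    exact ENNReal.mul_lt_top ENNReal.ofReal_lt_top (η.2 K hK)⟩

instance currentMulAction (X : Type*) [TopologicalSpace X] [T2Space X] [MeasurableSpace X]
    [BorelSpace X] : MulAction (currentGroup X) (RadonMeasure X) where
  one_smul η := by
    apply Subtype.ext
    change η.1.withDensity (fun x => ENNReal.ofReal (currentVal 1 x)) = η.1
    have h : (fun x : X => ENNReal.ofReal (currentVal 1 x)) = 1 := by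
      funext x
      simp [currentVal]
    rw [h, withDensity_one]
  mul_smul a b η := by
    apply Subtype.ext
    change η.1.withDensity (fun x => ENNReal.ofReal (currentVal (a * b) x)) =
      (η.1.withDensity fun x => ENNReal.ofReal (currentVal b x)).withDensity
        fun x => ENNReal.ofReal (currentVal a x)
    rw [← withDensity_mul _ (continuous_currentVal b).measurable.ennreal_ofReal
      (continuous_currentVal a).measurable.ennreal_ofReal]
    congr 1
    funext x
    have hb : 0 ≤ currentVal b x := (b.1 x).2.le
    rw [Pi.mul_apply, ← ENNReal.ofReal_mul hb, mul_comm]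
    rfl

/-- A probability law `μ` on `M` is quasi-invariant under the action of the group `G` if for each
`g` its pushforward under `g` is equivalent to `μ`. -/
def QuasiInvariant (G : Type*) {M : Type*} [SMul G M] [MeasurableSpace M] (μ : Measure M) : Prop :=
  ∀ g : G, μ.map (fun η => g • η) ≪ μ ∧ μ ≪ μ.map (fun η => g • η)

/-- Borel sets with compact closure. -/
def IsBoundedBorel {X : Type*} [TopologicalSpace X] [MeasurableSpace X] (A : Set X) : Prop :=
  MeasurableSet A ∧ IsCompact (closure A)

/-- `μ` is the law of a completely random measure on `X`: its values on finitely many disjoint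
Borel sets with compact closure are independent. -/
structure IsCompletelyRandom {X : Type*} [TopologicalSpace X] [MeasurableSpace X]
    (μ : Measure (RadonMeasure X)) : Prop where
  isProbabilityMeasure : IsProbabilityMeasure μ
  indep : ∀ (n : ℕ) (A : Fin n → Set X), (∀ i, IsBoundedBorel (A i)) →
    Pairwise (fun i j => Disjoint (A i) (A j)) →
    iIndepFun (fun (i : Fin n) (η : RadonMeasure X) => η.1 (A i)) μ

/-- `μ` is the law of a completely random discrete measure on `X` with Lévy measure `m`. Here `m` is
a measure on `X × (0, ∞)`, written as a measure on `X × ℝ` which does not charge `X × (-∞, 0]`. -/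
structure HasLevyMeasure {X : Type*} [TopologicalSpace X] [MeasurableSpace X]
    (m : Measure (X × ℝ)) (μ : Measure (RadonMeasure X)) : Prop where
  completelyRandom : IsCompletelyRandom μ
  discrete : ∀ᵐ η ∂μ, η ∈ discreteRadon X
  fourier : ∀ f : C_c(X, ℝ),
    ∫ η : RadonMeasure X, Complex.exp (Complex.I * ((∫ x, f x ∂η.1 : ℝ) : ℂ)) ∂μ =
      Complex.exp (∫ p, (Complex.exp (Complex.I * ((p.2 * f p.1 : ℝ) : ℂ)) - 1) ∂m)

/-- The measure `dm(x,s) = (l(x,s)/s) dσ(x) ds` on `X × (0, ∞)`. -/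
def levyMeasure {X : Type*} [MeasurableSpace X] (σ : Measure X) (l : X → ℝ → ℝ) :
    Measure (X × ℝ) :=
  (σ.prod (volume.restrict (Ioi (0 : ℝ)))).withDensity fun p => ENNReal.ofReal (l p.1 p.2 / p.2)

/-- The set `Y` of points `x` for which `l(x, ·)` is positive on `(0, ∞)`. -/
def positivitySet {X : Type*} (l : X → ℝ → ℝ) : Set X := {x | ∀ s, 0 < s → 0 < l x s}

/-- The function `x ↦ log (l(x, θ⁻¹(x) s_x) / l(x, s_x)) s_x⁻¹`, where `s_x = η({x})`. -/
def logRatio {X : Type*} [TopologicalSpace X] [MeasurableSpace X] (l : X → ℝ → ℝ)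
    (θ : currentGroup X) (η : RadonMeasure X) (x : X) : ℝ :=
  Real.log (l x ((currentVal θ x)⁻¹ * η.weight x) / l x (η.weight x)) * (η.weight x)⁻¹

end

/-! Under the law with Lévy measure m the pairs (atom, weight) form a Poisson process on X × (0, ∞)
with intensity m, and everything follows from the exponential formula E exp Σ f(x, s_x) = exp ∫ (e^f
- 1) dm for complex f (`exp_integral_count`). For f(x, s) = i s g(x) it gives the Fourier
functional. That functional determines the law (`ext_of_fourier`), so uniqueness is immediate and
any completely random discrete measure with Lévy measure m is the one built from Poisson
configurations.

A current θ moves the pair (x, s) to (x, θ(x) s). Since σ ⊗ ds/s is invariant under this map, m is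
carried to e^φ m with φ(x, s) = log (l(x, s/θ(x)) / l(x, s)). The exponential formula for i s g + φ
shows that exp (Σ φ - ∫ (e^φ - 1) dm) dμ has Fourier functional exp ∫ e^φ (e^{isg} - 1) dm, which is
also that of the pushforward under θ (`map_smul_eq_withDensity`). The density is strictly positive,
hence the equivalence.

The analytic input is that e^φ - 1 lies in L¹(m), that is, l(x, s) - l(x, s/θ(x)) is integrable for
σ ⊗ ds/s (`integrable_scaleDiff`). Near s = 0 this is the regularity hypothesis; away from 0 each
term is integrable on its own, because m has finite mass there over compact sets. It follows that
min(|φ|, 1) lies in L¹(m), which is enough for Σ φ to converge absolutely almost surely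
(`ae_integrable_count`), even when φ itself is not m-integrable. -/

open Filter Topology

/-! ### The vague topology, its Borel σ-algebra, and Fourier functionals. -/

namespace RadonMeasure

section Basic

variable {X : Type*} [TopologicalSpace X] [MeasurableSpace X]

instance isFiniteMeasureOnCompacts (η : RadonMeasure X) : IsFiniteMeasureOnCompacts η.1 :=
  ⟨fun K hK => η.2 K hK⟩

theorem integrable [OpensMeasurableSpace X] [T2Space X] (η : RadonMeasure X) (f : C_c(X, ℝ)) :
    Integrable f η.1 :=
  f.continuous.integrable_of_hasCompactSupport f.hasCompactSupport

theorem continuous_integral (f : C_c(X, ℝ)) :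
    Continuous fun η : RadonMeasure X => ∫ x, f x ∂η.1 :=
  continuous_iff_le_induced.2 (iInf_le _ f)

theorem measurable_integral (f : C_c(X, ℝ)) :
    Measurable fun η : RadonMeasure X => ∫ x, f x ∂η.1 :=
  (continuous_integral f).measurable

end Basic

variable {X : Type*} [TopologicalSpace X] [LocallyCompactSpace X] [PolishSpace X]

/-- A compactly supported function with values in `[0, 1]` equal to `1` on a given compact set. -/
theorem exists_bump {K : Set X} (hK : IsCompact K) :
    ∃ f : C_c(X, ℝ), (∀ x ∈ K, f x = 1) ∧ ∀ x, f x ∈ Icc (0 : ℝ) 1 := by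
  obtain ⟨f, h1, h2, -, h3⟩ := exists_continuousMap_one_of_isCompact_subset_isOpen hK isOpen_univ
    (subset_univ K)
  exact ⟨⟨f, h2⟩, fun x hx => h1 hx, h3⟩

/-- The integrals against the members of a countable family of compactly supported continuous
functions determine the vague topology. -/
theorem exists_countable_family [MeasurableSpace X] [BorelSpace X] :
    ∃ F : ℕ → C_c(X, ℝ), RadonMeasure.vagueTopology X =
      TopologicalSpace.induced (fun (η : RadonMeasure X) n => ∫ x, F n x ∂η.1) inferInstance := by
  let E : CompactExhaustion X := default
  choose φ hφ1 hφ2 using fun n => exists_bump (E.isCompact n)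
  let D : ℕ → C(X, ℝ) := TopologicalSpace.denseSeq C(X, ℝ)
  let G : ℕ → ℕ → C_c(X, ℝ) := fun n k =>
    ⟨⟨fun x => φ n x * D k x, (φ n).continuous.mul (D k).continuous⟩,
      (φ n).hasCompactSupport.mul_right⟩
  -- The bumps `φ n` must belong to the family: their integrals control the error made when `f` is
  -- replaced by some `φ n * D k`.
  let F : ℕ → C_c(X, ℝ) := fun j => Sum.elim φ (fun p : ℕ × ℕ => G p.1 p.2)
    ((Denumerable.eqv (ℕ ⊕ ℕ × ℕ)).symm j)
  have hFφ : ∀ n, ∃ j, F j = φ n := fun n => 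
    ⟨Denumerable.eqv (ℕ ⊕ ℕ × ℕ) (Sum.inl n), by simp [F]⟩
  have hFG : ∀ n k, ∃ j, F j = G n k := fun n k =>
    ⟨Denumerable.eqv (ℕ ⊕ ℕ × ℕ) (Sum.inr (n, k)), by simp [F]⟩
  refine ⟨F, le_antisymm ?_ ?_⟩
  · exact continuous_iff_le_induced.1 (continuous_pi fun n => continuous_integral (F n))
  refine le_iInf fun f => ?_
  let τ : TopologicalSpace (RadonMeasure X) :=
    TopologicalSpace.induced (fun (η : RadonMeasure X) n => ∫ x, F n x ∂η.1) inferInstance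
  have hJ : Continuous[τ, _] fun (η : RadonMeasure X) n => ∫ x, F n x ∂η.1 :=
    continuous_induced_dom
  have hF : ∀ j, Continuous[τ, _] fun η : RadonMeasure X => ∫ x, F j x ∂η.1 := fun j =>
    (continuous_apply j).comp hJ
  have hφ : ∀ n, Continuous[τ, _] fun η : RadonMeasure X => ∫ x, φ n x ∂η.1 := fun n => by
    obtain ⟨j, hj⟩ := hFφ n
    rw [← hj]; exact hF j
  have hG : ∀ n k, Continuous[τ, _] fun η : RadonMeasure X => ∫ x, G n k x ∂η.1 := fun n k => by
    obtain ⟨j, hj⟩ := hFG n k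
    rw [← hj]; exact hF j
  refine continuous_iff_le_induced.1 ?_
  obtain ⟨n, hn⟩ : ∃ n, tsupport f ⊆ E n := E.exists_superset_of_isCompact f.hasCompactSupport
  have hfφ : ∀ x, f x = φ n x * f x := fun x => by
    by_cases hx : x ∈ tsupport f
    · rw [hφ1 n x (hn hx), one_mul]
    · rw [image_eq_zero_of_notMem_tsupport hx, mul_zero]
  have approx : ∀ ε > 0, ∃ k, ∀ η : RadonMeasure X,
      |∫ x, f x ∂η.1 - ∫ x, G n k x ∂η.1| ≤ ε * ∫ x, φ n x ∂η.1 := by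
    intro ε hε
    have hopen : IsOpen {g : C(X, ℝ) | MapsTo (g - f.toContinuousMap)
        (tsupport (φ n)) (Metric.ball 0 ε)} :=
      (ContinuousMap.isOpen_setOfPred_mapsTo (φ n).hasCompactSupport.isCompact
        Metric.isOpen_ball).preimage (continuous_id.sub continuous_const)
    obtain ⟨k, hk⟩ := (TopologicalSpace.denseRange_denseSeq C(X, ℝ)).exists_mem_open hopen
      ⟨f.toContinuousMap, fun x _ => by simpa using hε⟩
    refine ⟨k, fun η => ?_⟩
    rw [← integral_sub (η.integrable f) (η.integrable (G n k)), ← integral_const_mul]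
    refine abs_integral_le_integral_abs.trans (integral_mono
      ((η.integrable f).sub (η.integrable (G n k))).abs ((η.integrable (φ n)).const_mul ε)
      fun x => ?_)
    change |f x - φ n x * D k x| ≤ ε * φ n x
    rw [hfφ x, ← mul_sub, abs_mul, abs_of_nonneg (hφ2 n x).1, mul_comm]
    by_cases hx : x ∈ tsupport (φ n)
    · refine mul_le_mul_of_nonneg_right ?_ (hφ2 n x).1
      have := hk hx
      rw [mem_ball_zero_iff, Real.norm_eq_abs] at this
      rw [abs_sub_comm]; exact this.le
    · simp [image_eq_zero_of_notMem_tsupport hx]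
  rw [continuous_iff_continuousAt]
  intro η₀
  rw [ContinuousAt, Metric.tendsto_nhds]
  intro δ hδ
  have hB0 : ∀ η : RadonMeasure X, 0 ≤ ∫ x, φ n x ∂η.1 := fun η =>
    integral_nonneg fun x => (hφ2 n x).1
  -- Near `η₀` the integral of `φ n` stays below `B`, so one `k` makes the approximation error at
  -- most `δ / 3` for `η₀` and for all nearby `η` at once.
  set B := ∫ x, φ n x ∂η₀.1 + 1 with hB
  have hBpos : 0 < B := by linarith [hB0 η₀]
  obtain ⟨k, hk⟩ := approx (δ / (3 * B)) (by positivity)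
  have e1 : ∀ᶠ η in 𝓝 η₀, ∫ x, φ n x ∂η.1 < B :=
    (hφ n).continuousAt.eventually (Iio_mem_nhds (by linarith))
  have e2 : ∀ᶠ η in 𝓝 η₀, dist (∫ x, G n k x ∂η.1) (∫ x, G n k x ∂η₀.1) < δ / 3 :=
    Metric.tendsto_nhds.1 (hG n k).continuousAt _ (by positivity)
  have key : ∀ η : RadonMeasure X, ∫ x, φ n x ∂η.1 < B →
      |∫ x, f x ∂η.1 - ∫ x, G n k x ∂η.1| ≤ δ / 3 := fun η hη => by
    refine (hk η).trans ?_
    calc δ / (3 * B) * ∫ x, φ n x ∂η.1 ≤ δ / (3 * B) * B := by gcongr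
      _ = δ / 3 := by field_simp
  filter_upwards [e1, e2] with η h1 h2
  have h3 := key η h1
  have h4 := key η₀ (by linarith)
  rw [Real.dist_eq] at h2 ⊢
  rw [abs_le] at h3 h4
  rw [abs_lt] at h2 ⊢
  constructor <;> linarith [h2.1, h2.2, h3.1, h3.2, h4.1, h4.2]

variable [MeasurableSpace X] [BorelSpace X]

/-- The topology is induced from `ℕ → ℝ`, whose Borel σ-algebra is the product one. Measurability of
maps and equality of laws thus reduce to countably many real integrals. -/
theorem exists_countable_family_measurable :
    ∃ F : ℕ → C_c(X, ℝ), RadonMeasure.measurableSpace X =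
      MeasurableSpace.comap (fun (η : RadonMeasure X) n => ∫ x, F n x ∂η.1) inferInstance := by
  obtain ⟨F, hF⟩ := exists_countable_family (X := X)
  refine ⟨F, ?_⟩
  rw [RadonMeasure.measurableSpace, hF, borel_comap, BorelSpace.measurable_eq (α := ℕ → ℝ)]

theorem measurable_of_integral {Ω : Type*} [MeasurableSpace Ω] {Φ : Ω → RadonMeasure X}
    (h : ∀ f : C_c(X, ℝ), Measurable fun ω => ∫ x, f x ∂(Φ ω).1) : Measurable Φ := by
  obtain ⟨F, hF⟩ := exists_countable_family_measurable (X := X)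
  rw [hF, measurable_comap_iff]
  exact measurable_pi_lambda _ fun n => h (F n)

/-- The indicator of `K` is a pointwise limit of continuous functions; multiplying them by a bump
makes their supports compact and provides the dominating function. -/
theorem measurable_apply_isCompact {K : Set X} (hK : IsCompact K) :
    Measurable fun η : RadonMeasure X => η.1 K := by
  let _ := TopologicalSpace.upgradeIsCompletelyMetrizable X
  obtain ⟨φ, hφ1, hφ2⟩ := exists_bump hK
  let A : ℕ → C_c(X, ℝ) := fun n =>
    ⟨⟨fun x => φ x * hK.isClosed.apprSeq n x, by fun_prop⟩, φ.hasCompactSupport.mul_right⟩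
  have hA : ∀ η : RadonMeasure X, Tendsto (fun n => ∫ x, A n x ∂η.1) atTop (𝓝 (η.1.real K)) := by
    intro η
    rw [← integral_indicator_one hK.measurableSet]
    refine tendsto_integral_of_dominated_convergence φ
      (fun n => (A n).continuous.aestronglyMeasurable) (η.integrable φ) (fun n => ?_) ?_
    · refine Eventually.of_forall fun x => ?_
      change ‖φ x * _‖ ≤ φ x
      rw [norm_mul, Real.norm_of_nonneg (hφ2 x).1, Real.norm_of_nonneg (NNReal.coe_nonneg _)]
      exact mul_le_of_le_one_right (hφ2 x).1
        (NNReal.coe_le_one.2 (HasOuterApproxClosed.apprSeq_apply_le_one hK.isClosed n x))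
    · refine Eventually.of_forall fun x => ?_
      have h1 := (tendsto_pi_nhds.1 (HasOuterApproxClosed.tendsto_apprSeq hK.isClosed)) x
      have h2 : Tendsto (fun n => φ x * (hK.isClosed.apprSeq n x : ℝ)) atTop
          (𝓝 (φ x * ((indicator K (fun _ => (1 : NNReal)) x : NNReal) : ℝ))) :=
        tendsto_const_nhds.mul ((NNReal.continuous_coe.tendsto _).comp h1)
      have h3 : K.indicator (1 : X → ℝ) x =
          φ x * ((indicator K (fun _ => (1 : NNReal)) x : NNReal) : ℝ) := by
        by_cases hx : x ∈ K
        · simp [hx, hφ1 x hx]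
        · simp [hx]
      rw [h3]
      exact h2
  have hm : Measurable fun η : RadonMeasure X => η.1.real K :=
    measurable_of_tendsto_metrizable (fun n => measurable_integral (A n)) (tendsto_pi_nhds.2 hA)
  have : (fun η : RadonMeasure X => η.1 K) = fun η => ENNReal.ofReal (η.1.real K) := by
    funext η
    rw [measureReal_def, ENNReal.ofReal_toReal (η.2 K hK).ne]
  rw [this]
  exact hm.ennreal_ofReal

/-- The restrictions to the sets of a compact exhaustion are finite measures, for which the π-system
of closed sets suffices; the exhaustion then recovers the whole measure as a supremum. -/
theorem measurable_val : Measurable fun η : RadonMeasure X => η.1 := by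
  let E : CompactExhaustion X := default
  have h : ∀ n, Measurable fun η : RadonMeasure X => η.1.restrict (E n) := fun n => by
    have : ∀ η : RadonMeasure X, IsFiniteMeasure (η.1.restrict (E n)) := fun η =>
      ⟨by simpa using η.2 _ (E.isCompact n)⟩
    refine Measurable.measure_of_isPiSystem
      ((BorelSpace.measurable_eq (α := X)).trans borel_eq_generateFrom_isClosed)
      isPiSystem_isClosed (fun s hs => ?_) ?_
    · simp only [Measure.restrict_apply hs.measurableSet]
      exact measurable_apply_isCompact ((E.isCompact n).inter_left hs)
    · simp only [Measure.restrict_apply_univ]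
      exact measurable_apply_isCompact (E.isCompact n)
  rw [Measure.measurable_measure]
  intro s hs
  have hsup : (fun η : RadonMeasure X => η.1 s) = fun η => ⨆ n, η.1.restrict (E n) s := by
    funext η
    have : s = ⋃ n, s ∩ E n := by rw [← inter_iUnion, E.iUnion_eq, inter_univ]
    conv_lhs => rw [this]
    rw [Monotone.measure_iUnion]
    · simp only [Measure.restrict_apply hs]
    · exact fun i j hij => inter_subset_inter_right _ (E.subset hij)
  rw [hsup]
  exact Measurable.iSup fun n => (Measure.measurable_measure.1 (h n)) s hs

theorem measurable_iff_val {Ω : Type*} [MeasurableSpace Ω] {Φ : Ω → RadonMeasure X} :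
    Measurable Φ ↔ Measurable fun ω => (Φ ω).1 := by
  refine ⟨fun h => measurable_val.comp h, fun h => measurable_of_integral fun f => ?_⟩
  have hpos : ∀ g : C_c(X, ℝ), Measurable fun ω => ∫⁻ x, ENNReal.ofReal (g x) ∂(Φ ω).1 := fun g =>
    (Measure.measurable_lintegral g.continuous.measurable.ennreal_ofReal).comp h
  have : (fun ω => ∫ x, f x ∂(Φ ω).1) = fun ω => (∫⁻ x, ENNReal.ofReal (f x) ∂(Φ ω).1).toReal -
      (∫⁻ x, ENNReal.ofReal ((-f) x) ∂(Φ ω).1).toReal := by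
    funext ω
    rw [integral_eq_lintegral_pos_part_sub_lintegral_neg_part ((Φ ω).integrable f)]
    rfl
  rw [this]
  exact (hpos f).ennreal_toReal.sub (hpos (-f)).ennreal_toReal

/-- Two finite measures on the space of Radon measures with the same Fourier functional agree. -/
theorem ext_of_fourier {μ ν : Measure (RadonMeasure X)} [IsFiniteMeasure μ] [IsFiniteMeasure ν]
    (h : ∀ f : C_c(X, ℝ),
      ∫ η : RadonMeasure X, Complex.exp (Complex.I * ((∫ x, f x ∂η.1 : ℝ) : ℂ)) ∂μ =
      ∫ η : RadonMeasure X, Complex.exp (Complex.I * ((∫ x, f x ∂η.1 : ℝ) : ℂ)) ∂ν) : μ = ν := by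
  obtain ⟨F, hF⟩ := exists_countable_family_measurable (X := X)
  set J : RadonMeasure X → ℕ → ℝ := fun η n => ∫ x, F n x ∂η.1 with hJ
  have hJm : Measurable J := measurable_pi_lambda _ fun n => measurable_integral (F n)
  have hmap : μ.map J = ν.map J := by
    have hlim : ∀ κ : Measure (RadonMeasure X), IsProjectiveLimit (κ.map J)
        fun I : Finset ℕ => (κ.map J).map I.restrict := fun κ I => rfl
    refine (hlim μ).unique (P := fun I : Finset ℕ => (μ.map J).map I.restrict) ?_
    intro I
    change (ν.map J).map I.restrict = (μ.map J).map I.restrict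
    rw [Measure.map_map (Finset.measurable_restrict I) hJm,
      Measure.map_map (Finset.measurable_restrict I) hJm]
    have hIm : Measurable (I.restrict ∘ J) := (Finset.measurable_restrict I).comp hJm
    let T := MeasurableEquiv.toLp 2 (I → ℝ)
    have hT : (ν.map (I.restrict ∘ J)).map T = (μ.map (I.restrict ∘ J)).map T := by
      -- By linearity, the characteristic function of a finite-dimensional marginal at `t` is the
      -- Fourier functional at the combination `∑ t i • F i`.
      refine Measure.ext_of_charFun (funext fun t => ?_)
      have hc : ∀ κ : Measure (RadonMeasure X), charFun ((κ.map (I.restrict ∘ J)).map T) t =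
          ∫ η : RadonMeasure X, Complex.exp (Complex.I *
            ((∫ x, (∑ i : I, t i • F i) x ∂η.1 : ℝ) : ℂ)) ∂κ := by
        intro κ
        rw [charFun_apply, integral_map T.measurable.aemeasurable
          (by fun_prop), integral_map hIm.aemeasurable (by fun_prop)]
        refine integral_congr_ae (Eventually.of_forall fun η => ?_)
        have : ∫ x, (∑ i : I, t i • F i) x ∂η.1 = ∑ i : I, t i * J η i := by
          simp only [CompactlySupportedContinuousMap.coe_sum, Finset.sum_apply,
            CompactlySupportedContinuousMap.coe_smul, Pi.smul_apply, smul_eq_mul]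
          rw [integral_finsetSum _ fun (i : I) _ => (η.integrable (F i)).const_mul (t i)]
          simp only [integral_const_mul, hJ]
        simp only [this]
        rw [mul_comm]
        congr 2
      rw [hc, hc, h]
    have := congrArg (fun m => m.map T.symm) hT
    simpa only [Measure.map_map T.symm.measurable T.measurable, MeasurableEquiv.symm_comp_self,
      Measure.map_id] using this
  ext s hs
  rw [hF] at hs
  obtain ⟨t, ht, rfl⟩ := hs
  rw [← Measure.map_apply hJm ht, ← Measure.map_apply hJm ht, hmap]

end RadonMeasure

/-! ### Atoms, the evaluation kernel and the action of currents. -/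

namespace RadonMeasure

variable {X : Type*} [TopologicalSpace X] [LocallyCompactSpace X] [PolishSpace X]
  [MeasurableSpace X] [BorelSpace X]

instance sigmaFinite (η : RadonMeasure X) : SigmaFinite η.1 :=
  have : IsLocallyFiniteMeasure η.1 := isLocallyFiniteMeasure_of_isFiniteMeasureOnCompacts
  inferInstance

theorem measurable_coe {A : Set X} (hA : MeasurableSet A) :
    Measurable fun η : RadonMeasure X => η.1 A :=
  Measure.measurable_measure.1 measurable_val A hA

/-- The evaluation kernel sending a Radon measure to itself. -/
noncomputable def kernel (X : Type*) [TopologicalSpace X] [LocallyCompactSpace X] [PolishSpace X]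
    [MeasurableSpace X] [BorelSpace X] : Kernel (RadonMeasure X) X :=
  ⟨fun η => η.1, measurable_val⟩

@[simp] theorem kernel_apply (η : RadonMeasure X) : kernel X η = η.1 := rfl

/-- On each relatively compact piece `D n` the mass is finite but not bounded in `η`, so the
restricted kernel need not be finite. Dividing by `η (D n) + 1`, where the `1` avoids a zero
divisor, gives a finite kernel, and the factor is put back as a density. -/
instance kernel_isSFiniteKernel : IsSFiniteKernel (kernel X) := by
  let E : CompactExhaustion X := default
  let D : ℕ → Set X := disjointed E
  have hDm : ∀ n, MeasurableSet (D n) :=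
    MeasurableSet.disjointed fun n => (E.isCompact n).measurableSet
  have hfin : ∀ n (η : RadonMeasure X), η.1 (D n) ≠ ∞ := fun n η =>
    ((measure_mono (disjointed_subset _ _)).trans_lt (η.2 _ (E.isCompact n))).ne
  let c : ℕ → RadonMeasure X → ℝ≥0∞ := fun n η => η.1 (D n) + 1
  have hc0 : ∀ n η, c n η ≠ 0 := fun n η => by simp [c]
  have hct : ∀ n η, c n η ≠ ∞ := fun n η => by simp [c, hfin n η]
  have hcm : ∀ n, Measurable (c n) := fun n => (measurable_coe (hDm n)).add_const 1
  let k : ℕ → Kernel (RadonMeasure X) X := fun n =>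
    ⟨fun η => (c n η)⁻¹ • η.1.restrict (D n), by
      refine Measure.measurable_of_measurable_coe _ fun s hs => ?_
      simp only [Measure.smul_apply, Measure.restrict_apply hs, smul_eq_mul]
      exact (hcm n).inv.mul (measurable_coe (hs.inter (hDm n)))⟩
  have hkfin : ∀ n, IsFiniteKernel (k n) := fun n => by
    refine ⟨1, ENNReal.one_lt_top, fun η => ?_⟩
    change (c n η)⁻¹ * (η.1.restrict (D n)) univ ≤ 1
    rw [Measure.restrict_apply_univ, mul_comm, ← div_eq_mul_inv]
    exact ENNReal.div_le_of_le_mul (by simp [c])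
  have hw : ∀ n, IsSFiniteKernel (Kernel.withDensity (k n) fun η _ => c n η) := fun n =>
    Kernel.IsSFiniteKernel.withDensity _ fun η _ => hct n η
  have hsum : kernel X = Kernel.sum fun n => Kernel.withDensity (k n) fun η _ => c n η := by
    ext1 η
    rw [Kernel.sum_apply, kernel_apply]
    have h1 : ∀ n, Kernel.withDensity (k n) (fun η _ => c n η) η = η.1.restrict (D n) := by
      intro n
      have hm : Measurable (Function.uncurry fun (η : RadonMeasure X) (_ : X) => c n η) :=
        (hcm n).comp measurable_fst
      rw [Kernel.withDensity_apply _ hm, withDensity_const]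
      change c n η • (c n η)⁻¹ • η.1.restrict (D n) = _
      rw [smul_smul, ENNReal.mul_inv_cancel (hc0 n η) (hct n η), one_smul]
    simp only [h1]
    rw [← Measure.restrict_iUnion (disjoint_disjointed _) hDm, iUnion_disjointed, E.iUnion_eq,
      Measure.restrict_univ]
  rw [hsum]
  infer_instance

/-- The mass of a singleton is the kernel measure of a section of the diagonal; joint measurability
comes from s-finiteness of the kernel. -/
theorem measurable_singleton_prod :
    Measurable fun p : RadonMeasure X × X => p.1.1 {p.2} := by
  have ht : MeasurableSet {q : (RadonMeasure X × X) × X | q.2 = q.1.2} :=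
    measurableSet_eq_fun measurable_snd (measurable_snd.comp measurable_fst)
  exact Kernel.measurable_kernel_prodMk_left
    (κ := (kernel X).comap Prod.fst measurable_fst) ht

theorem measurable_weight_prod : Measurable fun p : RadonMeasure X × X => p.1.weight p.2 :=
  measurable_singleton_prod.ennreal_toReal

theorem measurable_weight (η : RadonMeasure X) : Measurable η.weight :=
  measurable_weight_prod.comp measurable_prodMk_left

theorem measure_singleton_ne_top (η : RadonMeasure X) (x : X) : η.1 {x} ≠ ∞ :=
  (η.2 _ isCompact_singleton).ne

theorem ofReal_weight (η : RadonMeasure X) (x : X) : ENNReal.ofReal (η.weight x) = η.1 {x} :=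
  ENNReal.ofReal_toReal (η.measure_singleton_ne_top x)

/-- The Radon measures without diffuse part form a measurable set. -/
theorem measurableSet_diffuse_eq_zero :
    MeasurableSet {η : RadonMeasure X | η.1 {x | η.1 {x} = 0} = 0} := by
  have ht : MeasurableSet {q : RadonMeasure X × X | q.1.1 {q.2} = 0} :=
    measurable_singleton_prod (measurableSet_singleton 0)
  exact Kernel.measurable_kernel_prodMk_left (κ := kernel X) ht (measurableSet_singleton 0)

/-- A σ-finite measure has only countably many atoms, and one carried by its atoms is the sum of its
restrictions to them. This replaces discreteness by a condition that is visibly measurable, so that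
it can be transported to image laws. -/
theorem mem_discreteRadon_of_diffuse_eq_zero {η : RadonMeasure X}
    (h : η.1 {x | η.1 {x} = 0} = 0) : η ∈ discreteRadon X := by
  have hT : {x | 0 < η.1 {x}}.Countable := by
    have := Measure.countable_meas_level_set_pos (μ := η.1) (g := id) measurable_id
    simpa using this
  refine ⟨{x | 0 < η.1 {x}}, η.weight, hT, fun x hx => ENNReal.toReal_pos hx.ne'
    (η.measure_singleton_ne_top x), ?_⟩
  have : Countable {x | 0 < η.1 {x}} := hT
  have hae : {x | 0 < η.1 {x}} =ᵐ[η.1] univ := by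
    rw [ae_eq_univ]
    convert h using 2
    ext x
    simp
  conv_lhs => rw [← Measure.restrict_univ (μ := η.1), ← Measure.restrict_congr_set hae,
    ← biUnion_of_singleton {x | 0 < η.1 {x}}, biUnion_eq_iUnion]
  rw [Measure.restrict_iUnion (fun a b hab => by simpa using Subtype.coe_injective.ne hab)
    fun a => measurableSet_singleton _]
  congr 1
  funext x
  rw [Measure.restrict_singleton, ofReal_weight]

theorem ae_map_mem_discreteRadon {Ω : Type*} [MeasurableSpace Ω] {P : Measure Ω}
    {Φ : Ω → RadonMeasure X} (hΦ : Measurable Φ)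
    (h : ∀ᵐ ω ∂P, (Φ ω).1 {x | (Φ ω).1 {x} = 0} = 0) :
    ∀ᵐ η ∂P.map Φ, η ∈ discreteRadon X := by
  have h2 : ∀ᵐ η ∂P.map Φ, η.1 {x | η.1 {x} = 0} = 0 :=
    (ae_map_iff hΦ.aemeasurable measurableSet_diffuse_eq_zero).2 h
  exact h2.mono fun η hη => mem_discreteRadon_of_diffuse_eq_zero hη

theorem currentVal_pos (θ : currentGroup X) (x : X) : 0 < currentVal θ x := (θ.1 x).2

theorem smul_val (θ : currentGroup X) (η : RadonMeasure X) :
    (θ • η).1 = η.1.withDensity fun x => ENNReal.ofReal (currentVal θ x) := rfl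

theorem integral_smul (θ : currentGroup X) (η : RadonMeasure X) (f : X → ℝ) :
    ∫ x, f x ∂(θ • η).1 = ∫ x, currentVal θ x * f x ∂η.1 := by
  rw [smul_val, integral_withDensity_eq_integral_toReal_smul
    (continuous_currentVal θ).measurable.ennreal_ofReal
    (Eventually.of_forall fun _ => ENNReal.ofReal_lt_top)]
  refine integral_congr_ae (Eventually.of_forall fun x => ?_)
  simp only [smul_eq_mul]
  rw [ENNReal.toReal_ofReal (currentVal_pos θ x).le]

/-- The product of a current and a compactly supported continuous function. -/
noncomputable def currentMul (θ : currentGroup X) (f : C_c(X, ℝ)) : C_c(X, ℝ) :=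
  ⟨⟨fun x => currentVal θ x * f x, (continuous_currentVal θ).mul f.continuous⟩,
    f.hasCompactSupport.mul_left⟩

theorem measurable_smul (θ : currentGroup X) :
    Measurable fun η : RadonMeasure X => θ • η :=
  measurable_of_integral fun f => by
    simp only [integral_smul]
    exact measurable_integral (currentMul θ f)

theorem mapsTo_smul_discreteRadon (θ : currentGroup X) :
    MapsTo (fun η : RadonMeasure X => θ • η) (discreteRadon X) (discreteRadon X) := by
  rintro η ⟨T, s, hT, hs, hη⟩
  refine ⟨T, fun x => currentVal θ x * s x, hT, fun x hx => mul_pos (θ.1 x).2 (hs x hx), ?_⟩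
  have hm := (continuous_currentVal θ).measurable.ennreal_ofReal
  rw [smul_val, hη, withDensity_sum]
  congr 1
  funext x
  rw [withDensity_smul_measure, dirac_withDensity' hm, smul_smul, mul_comm,
    ← ENNReal.ofReal_mul (currentVal_pos θ x).le]

end RadonMeasure

/-! ### Poisson configurations with finite intensity. -/

/-- Finite configurations of points of `E`. -/
abbrev FiniteConfig (E : Type*) : Type _ := Σ N : ℕ, Fin N → E

theorem measurable_sigma_of_mk {ι γ : Type*} {β : ι → Type*} [∀ i, MeasurableSpace (β i)]
    [MeasurableSpace γ] {f : Sigma β → γ} (h : ∀ i, Measurable fun b => f ⟨i, b⟩) :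
    Measurable f := by
  intro s hs
  refine MeasurableSpace.measurableSet_iInf.2 fun i => ?_
  exact h i hs

theorem measurable_sigmaMk {ι : Type*} {β : ι → Type*} [∀ i, MeasurableSpace (β i)] (i : ι) :
    Measurable (Sigma.mk i : β i → Sigma β) := by
  intro s hs
  exact MeasurableSpace.measurableSet_iInf.1 hs i

namespace FiniteConfig

variable {E : Type*} [MeasurableSpace E]

theorem measurable_prod {R : Type*} [CommMonoid R] [MeasurableSpace R] [MeasurableMul₂ R]
    {h : E → R} (hh : Measurable h) : Measurable fun b : FiniteConfig E => ∏ k, h (b.2 k) :=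
  measurable_sigma_of_mk fun N => Finset.measurable_fun_prod Finset.univ
    (f := fun (k : Fin N) (ξ : Fin N → E) => h (ξ k)) fun k _ => hh.comp (measurable_pi_apply k)

theorem measurable_sum {R : Type*} [AddCommMonoid R] [MeasurableSpace R] [MeasurableAdd₂ R]
    {h : E → R} (hh : Measurable h) : Measurable fun b : FiniteConfig E => ∑ k, h (b.2 k) :=
  measurable_sigma_of_mk fun N => Finset.measurable_fun_sum Finset.univ
    (f := fun (k : Fin N) (ξ : Fin N → E) => h (ξ k)) fun k _ => hh.comp (measurable_pi_apply k)

/-- The probability that a Poisson configuration with intensity `m` has `N` points, divided by the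
mass of `m` to the power `N`. -/
noncomputable def coeff (m : Measure E) (N : ℕ) : ℝ := Real.exp (-m.real univ) * (N.factorial : ℝ)⁻¹

theorem coeff_nonneg (m : Measure E) (N : ℕ) : 0 ≤ coeff m N := by unfold coeff; positivity

/-- The law of a Poisson configuration with finite intensity `m`. -/
noncomputable def poissonLaw (m : Measure E) : Measure (FiniteConfig E) :=
  Measure.sum fun N => ENNReal.ofReal (coeff m N) •
    (Measure.pi fun _ : Fin N => m).map (Sigma.mk N)

variable (m : Measure E) [IsFiniteMeasure m]

theorem lintegral_poissonLaw {g : FiniteConfig E → ℝ≥0∞} (hg : Measurable g) :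
    ∫⁻ b, g b ∂poissonLaw m =
      ∑' N, ENNReal.ofReal (coeff m N) * ∫⁻ ξ, g ⟨N, ξ⟩ ∂(Measure.pi fun _ : Fin N => m) := by
  rw [poissonLaw, lintegral_sum_measure]
  refine tsum_congr fun N => ?_
  rw [lintegral_smul_measure, lintegral_map hg (measurable_sigmaMk N), smul_eq_mul]

theorem hasSum_coeff_mul_pow (z : ℂ) :
    HasSum (fun N => (coeff m N : ℂ) * z ^ N) (Complex.exp (z - m.real univ)) := by
  have h := (NormedSpace.expSeries_div_hasSum_exp (𝔸 := ℂ) z).mul_left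
    (Complex.exp (-(m.real univ : ℂ)))
  rw [← Complex.exp_eq_exp_ℂ, ← Complex.exp_add] at h
  have e1 : (fun N => (coeff m N : ℂ) * z ^ N) =
      fun N => Complex.exp (-(m.real univ : ℂ)) * (z ^ N / (N.factorial : ℂ)) := by
    funext N
    simp only [coeff]
    push_cast
    ring
  rw [e1, sub_eq_neg_add]
  exact h

variable {m}

theorem integrable_prod {h : E → ℂ} (hh : Integrable h m) (hm : Measurable h) :
    Integrable (fun b : FiniteConfig E => ∏ k, h (b.2 k)) (poissonLaw m) := by
  have hmap : ∀ N, Integrable (fun ξ : Fin N → E => ∏ k, h (ξ k)) (Measure.pi fun _ => m) :=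
    fun N => Integrable.fintype_prod fun _ => hh
  have hmeas := (measurable_prod hm).aestronglyMeasurable (μ := poissonLaw m)
  refine integrable_sum_measure (fun N => ?_) ?_
  · refine Integrable.smul_measure ?_ ENNReal.ofReal_ne_top
    rw [integrable_map_measure (measurable_prod hm).aestronglyMeasurable
      (measurable_sigmaMk N).aemeasurable]
    exact hmap N
  · have : ∀ N, ∫ b : FiniteConfig E, ‖∏ k, h (b.2 k)‖ ∂(ENNReal.ofReal (coeff m N) •
        (Measure.pi fun _ : Fin N => m).map (Sigma.mk N)) =
        coeff m N * (∫ x, ‖h x‖ ∂m) ^ N := fun N => by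
      rw [integral_smul_measure, integral_map (measurable_sigmaMk N).aemeasurable
        (measurable_prod hm).norm.aestronglyMeasurable, ENNReal.toReal_ofReal (coeff_nonneg m N),
        smul_eq_mul]
      simp only [norm_prod]
      rw [integral_fintype_prod_eq_pow (fun x => ‖h x‖), Fintype.card_fin]
    simp only [this]
    have := (hasSum_coeff_mul_pow m ((∫ x, ‖h x‖ ∂m : ℝ) : ℂ)).summable
    exact_mod_cast this

/-- On configurations of size `N` the integral factors into an `N`-th power, and the sum over `N` is
the exponential series. -/
theorem integral_prod {h : E → ℂ} (hh : Integrable h m) (hm : Measurable h) :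
    ∫ b : FiniteConfig E, ∏ k, h (b.2 k) ∂poissonLaw m =
      Complex.exp (∫ x, h x ∂m - m.real univ) := by
  rw [← (hasSum_coeff_mul_pow m _).tsum_eq]
  have hint := integrable_prod hh hm
  rw [poissonLaw] at hint ⊢
  rw [integral_sum_measure hint]
  refine tsum_congr fun N => ?_
  rw [integral_smul_measure, integral_map (measurable_sigmaMk N).aemeasurable
    (measurable_prod hm).aestronglyMeasurable, ENNReal.toReal_ofReal (coeff_nonneg m N)]
  rw [integral_fintype_prod_eq_pow h, Fintype.card_fin, Complex.real_smul]

instance : IsProbabilityMeasure (poissonLaw m) := by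
  -- The total mass is the case `h = 1` of the product formula.
  have h1 : Integrable (fun _ : E => (1 : ℂ)) m := integrable_const _
  have h2 := integrable_prod h1 measurable_const
  have h3 := integral_prod h1 measurable_const
  simp only [Finset.prod_const_one] at h2 h3
  rw [integral_const, integral_const] at h3
  simp only [Complex.real_smul, mul_one, sub_self, Complex.exp_zero] at h3
  constructor
  have h4 : (poissonLaw m).real univ = 1 := by exact_mod_cast h3
  rw [measureReal_def] at h4
  exact (ENNReal.toReal_eq_one_iff _).1 h4

theorem integral_prod_exp_sub {h : E → ℂ} (hh : Integrable (fun x => h x - 1) m)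
    (hm : Measurable h) :
    ∫ b : FiniteConfig E, ∏ k, h (b.2 k) ∂poissonLaw m = Complex.exp (∫ x, (h x - 1) ∂m) := by
  have hi : Integrable h m :=
    (hh.add (integrable_const (1 : ℂ))).congr (Eventually.of_forall fun x => by simp)
  rw [integral_prod hi hm, integral_sub hi (integrable_const _)]
  simp

/-- With `g = |e^f - 1|` these products majorize those of `e^f`; their expectation controls the
dominated convergence in the exponential formula. -/
theorem lintegral_prod_one_add {g : E → ℝ} (hg : Integrable g m) (hm : Measurable g)
    (h0 : ∀ x, 0 ≤ g x) :
    ∫⁻ b : FiniteConfig E, ENNReal.ofReal (∏ k, (1 + g (b.2 k))) ∂poissonLaw m =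
      ENNReal.ofReal (Real.exp (∫ x, g x ∂m)) := by
  have hm' : Measurable fun x => ((1 + g x : ℝ) : ℂ) :=
    Complex.measurable_ofReal.comp (hm.const_add 1)
  have hi : Integrable (fun x => ((1 + g x : ℝ) : ℂ)) m :=
    ((integrable_const (1 : ℝ)).add hg).ofReal
  have hi' : Integrable (fun x => ((1 + g x : ℝ) : ℂ) - 1) m := hi.sub (integrable_const _)
  have h1 := integrable_prod hi hm'
  have h2 := integral_prod_exp_sub hi' hm'
  have e : ∀ b : FiniteConfig E, (∏ k, ((1 + g (b.2 k) : ℝ) : ℂ)) =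
    ((∏ k, (1 + g (b.2 k)) : ℝ) : ℂ) := fun b => by push_cast; rfl
  have e2 : ∀ x, ((1 + g x : ℝ) : ℂ) - 1 = ((g x : ℝ) : ℂ) := fun x => by push_cast; ring
  simp only [e] at h1 h2
  simp only [e2] at h2
  rw [integral_complex_ofReal, integral_complex_ofReal, ← Complex.ofReal_exp] at h2
  rw [← ofReal_integral_eq_lintegral_ofReal, Complex.ofReal_injective h2]
  · refine h1.re.congr (Eventually.of_forall fun b => ?_)
    simp only [RCLike.re_to_complex, Complex.ofReal_re]
  · exact Eventually.of_forall fun b => Finset.prod_nonneg fun k _ => by linarith [h0 (b.2 k)]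

/-- Each of the `N + 1` coordinates contributes `m univ ^ N * ∫ g`, and `(N + 1) * coeff m (N + 1) =
coeff m N`. After the shift of index the remaining series is the total mass, which is one. -/
theorem lintegral_sum {g : E → ℝ≥0∞} (hg : Measurable g) :
    ∫⁻ b : FiniteConfig E, ∑ k, g (b.2 k) ∂poissonLaw m = ∫⁻ x, g x ∂m := by
  have h1 : ∑' N, ENNReal.ofReal (coeff m N) * (m univ) ^ N = 1 := by
    have := lintegral_poissonLaw m (g := 1) measurable_one
    simp only [Pi.one_apply, lintegral_one, measure_univ, Measure.pi_univ, Finset.prod_const,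
      Finset.card_univ, Fintype.card_fin] at this
    exact this.symm
  rw [lintegral_poissonLaw m (measurable_sum hg), tsum_eq_zero_add' ENNReal.summable]
  have h2 : ∀ N, ENNReal.ofReal (coeff m (N + 1)) *
      ∫⁻ ξ, ∑ k, g (ξ k) ∂(Measure.pi fun _ : Fin (N + 1) => m) =
      ENNReal.ofReal (coeff m N) * (m univ) ^ N * ∫⁻ x, g x ∂m := fun N => by
    rw [lintegral_finsetSum (f := fun (k : Fin (N + 1)) (ξ : Fin (N + 1) → E) => g (ξ k)) _
      fun k _ => hg.comp (measurable_pi_apply k)]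
    have : ∀ k : Fin (N + 1), ∫⁻ ξ, g (ξ k) ∂(Measure.pi fun _ : Fin (N + 1) => m) =
        (m univ) ^ N * ∫⁻ x, g x ∂m := fun k => by
      have hk := Measure.pi_map_eval (fun _ : Fin (N + 1) => m) k
      have h3 := lintegral_map (μ := Measure.pi fun _ : Fin (N + 1) => m) hg (measurable_pi_apply k)
      change ∫⁻ x, g x ∂(Measure.map (Function.eval k) (Measure.pi fun _ : Fin (N + 1) => m)) = _
        at h3
      rw [← h3, hk, lintegral_smul_measure]
      simp [Finset.prod_const, Finset.card_erase_of_mem]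
    rw [Finset.sum_congr rfl fun k _ => this k, Finset.sum_const, Finset.card_univ,
      Fintype.card_fin, nsmul_eq_mul, ← mul_assoc, ← mul_assoc]
    congr 2
    rw [← ENNReal.ofReal_natCast, ← ENNReal.ofReal_mul (coeff_nonneg m _)]
    congr 1
    rw [coeff, coeff, Nat.factorial_succ]
    push_cast
    field_simp
  simp only [h2]
  rw [ENNReal.tsum_mul_right, h1]
  simp

end FiniteConfig

/-! ### Poisson processes of s-finite intensity, Campbell's formula and the exponential formula. -/

namespace PoissonProcess

variable {E : Type*}

/-- The labels of the points of a sequence of finite configurations. -/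
abbrev Index (ω : ℕ → FiniteConfig E) : Type := Σ n, Fin (ω n).1

/-- The point with a given label. -/
def point (ω : ℕ → FiniteConfig E) (i : Index ω) : E := (ω i.1).2 i.2

variable [MeasurableSpace E]

/-- The counting measure of the points of a sequence of finite configurations. -/
noncomputable def count (ω : ℕ → FiniteConfig E) : Measure E :=
  Measure.sum fun i : Index ω => Measure.dirac (point ω i)

/-- The law of a sequence of independent Poisson configurations; the intensity of the point process
of all points is `Measure.sum m`. -/
noncomputable def law (m : ℕ → Measure E) [∀ n, IsFiniteMeasure (m n)] :
    Measure (ℕ → FiniteConfig E) :=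
  Measure.infinitePi fun n => FiniteConfig.poissonLaw (m n)

theorem lintegral_count {g : E → ℝ≥0∞} (hg : Measurable g) (ω : ℕ → FiniteConfig E) :
    ∫⁻ x, g x ∂count ω = ∑' n, ∑ k, g ((ω n).2 k) := by
  rw [count, lintegral_sum_measure,
    ENNReal.tsum_sigma fun n (k : Fin (ω n).1) => ∫⁻ x, g x ∂Measure.dirac (point ω ⟨n, k⟩)]
  refine tsum_congr fun n => ?_
  rw [tsum_fintype]
  exact Finset.sum_congr rfl fun k _ => lintegral_dirac' _ hg

theorem measurable_lintegral_count {g : E → ℝ≥0∞} (hg : Measurable g) :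
    Measurable fun ω => ∫⁻ x, g x ∂count (E := E) ω := by
  simp only [lintegral_count hg]
  exact Measurable.tsum fun n => (FiniteConfig.measurable_sum hg).comp (measurable_pi_apply n)

variable [MeasurableSingletonClass E]

theorem ae_count_iff {ω : ℕ → FiniteConfig E} {p : E → Prop} :
    (∀ᵐ x ∂count ω, p x) ↔ ∀ i, p (point ω i) := by
  rw [count, Measure.ae_sum_iff]
  simp [ae_dirac_eq]

theorem integrable_count_iff {F : Type*} [NormedAddCommGroup F] {ω : ℕ → FiniteConfig E}
    {f : E → F} : Integrable f (count ω) ↔ Summable fun i => ‖f (point ω i)‖ := by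
  have := integrable_sum_dirac_iff (f := f) (x := point ω) (c := fun _ => 1) (by simp)
  simp only [one_smul, ENNReal.toReal_one, one_mul] at this
  exact this

theorem hasSum_integral_count {ω : ℕ → FiniteConfig E} {f : E → ℂ}
    (hf : Integrable f (count ω)) :
    HasSum (fun n => ∑ k, f ((ω n).2 k)) (∫ x, f x ∂count ω) := by
  have h := hasSum_integral_measure hf
  simp only [integral_dirac] at h
  exact h.sigma fun n => hasSum_fintype _

variable (m : ℕ → Measure E) [∀ n, IsFiniteMeasure (m n)]

instance : IsProbabilityMeasure (law m) := by unfold law; infer_instance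

omit [MeasurableSingletonClass E] in
theorem lintegral_law_eval (n : ℕ) {g : FiniteConfig E → ℝ≥0∞} (hg : Measurable g) :
    ∫⁻ ω, g (ω n) ∂law m = ∫⁻ b, g b ∂FiniteConfig.poissonLaw (m n) :=
  (measurePreserving_eval_infinitePi (fun n => FiniteConfig.poissonLaw (m n)) n).lintegral_comp hg

omit [MeasurableSingletonClass E] in
/-- Campbell's formula. -/
theorem lintegral_lintegral_count {g : E → ℝ≥0∞} (hg : Measurable g) :
    ∫⁻ ω, ∫⁻ x, g x ∂count ω ∂law m = ∫⁻ x, g x ∂Measure.sum m := by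
  simp only [lintegral_count hg]
  rw [lintegral_tsum (f := fun n (ω : ℕ → FiniteConfig E) => ∑ k, g ((ω n).2 k)) fun n =>
    ((FiniteConfig.measurable_sum hg).comp (measurable_pi_apply n)).aemeasurable,
    lintegral_sum_measure]
  refine tsum_congr fun n => ?_
  rw [← FiniteConfig.lintegral_sum hg]
  exact lintegral_law_eval m n (FiniteConfig.measurable_sum hg)

theorem ae_lintegral_count_lt_top {g : E → ℝ≥0∞} (hg : Measurable g)
    (h : ∫⁻ x, g x ∂Measure.sum m < ∞) : ∀ᵐ ω ∂law m, ∫⁻ x, g x ∂count ω < ∞ := by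
  refine ae_lt_top (measurable_lintegral_count hg) ?_
  rw [lintegral_lintegral_count m hg]
  exact h.ne

/-- By Campbell's formula the expected number of points in an intensity-null set is zero. -/
theorem ae_forall_point {p : E → Prop} (hp : ∀ᵐ x ∂Measure.sum m, p x) :
    ∀ᵐ ω ∂law m, ∀ i, p (point ω i) := by
  obtain ⟨t, hpt, ht, ht0⟩ := exists_measurable_superset_of_null (ae_iff.1 hp)
  have h : ∫⁻ ω, count ω t ∂law m = 0 := by
    have := lintegral_lintegral_count m (g := t.indicator 1) (measurable_one.indicator ht)
    simpa only [lintegral_indicator_one ht, ht0] using this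
  have hm : Measurable fun ω => count (E := E) ω t := by
    have := measurable_lintegral_count (g := t.indicator 1) (measurable_one.indicator ht)
    simpa only [lintegral_indicator_one ht] using this
  rw [lintegral_eq_zero_iff hm] at h
  filter_upwards [h] with ω hω
  rw [← ae_count_iff]
  exact measure_mono_null hpt hω

/-- A function whose truncation at `1` is integrable for the intensity measure is almost surely
integrable for the point process. -/
theorem ae_integrable_count {F : Type*} [NormedAddCommGroup F] [MeasurableSpace F]
    [OpensMeasurableSpace F] {f : E → F} (hf : Measurable f)
    (h : ∫⁻ x, min ‖f x‖ₑ 1 ∂Measure.sum m < ∞) : ∀ᵐ ω ∂law m, Integrable f (count ω) := by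
  have hm : Measurable fun x => min ‖f x‖ₑ 1 := hf.enorm.min measurable_const
  filter_upwards [ae_lintegral_count_lt_top m hm h] with ω hω
  rw [integrable_count_iff]
  rw [count, lintegral_sum_measure] at hω
  simp only [lintegral_dirac' _ hm] at hω
  have hs : Summable fun i => min ‖f (point ω i)‖ 1 := by
    refine (ENNReal.summable_toReal hω.ne).congr fun i => ?_
    rw [ENNReal.toReal_min (by simp) (by simp)]
    simp
  -- Summability of the truncated norms leaves only finitely many points where the truncation is
  -- active.
  have hev : ∀ᶠ i in cofinite, min ‖f (point ω i)‖ 1 < 1 :=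
    hs.tendsto_cofinite_zero.eventually (Iio_mem_nhds one_pos)
  refine Summable.of_norm_bounded_eventually hs ?_
  filter_upwards [hev] with i hi
  rw [norm_norm]
  rcases min_lt_iff.1 hi with h1 | h1
  · exact le_min le_rfl h1.le
  · exact absurd h1 (lt_irrefl _)

section Product

theorem integrable_range_prod {h : E → ℂ} (hm : Measurable h)
    (hh : Integrable (fun x => h x - 1) (Measure.sum m)) (M : ℕ) :
    ∫ ω, ∏ n ∈ Finset.range M, ∏ k, h ((ω n).2 k) ∂law m =
      Complex.exp (∑ n ∈ Finset.range M, ∫ x, (h x - 1) ∂m n) := by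
  have hind : iIndepFun (fun (i : Finset.range M) (ω : ℕ → FiniteConfig E) =>
      ∏ k, h ((ω i).2 k)) (law m) :=
    (iIndepFun_infinitePi (P := fun n => FiniteConfig.poissonLaw (m n))
      (X := fun _ b => ∏ k, h (b.2 k)) fun _ => FiniteConfig.measurable_prod hm).precomp
      Subtype.coe_injective
  have hms : ∀ i : Finset.range M, AEStronglyMeasurable (fun ω : ℕ → FiniteConfig E =>
      ∏ k, h ((ω i).2 k)) (law m) := fun i =>
    ((FiniteConfig.measurable_prod hm).comp (measurable_pi_apply _)).aestronglyMeasurable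
  have h1 := hind.integral_fun_prod_eq_prod_integral hms
  have h2 : ∀ ω : ℕ → FiniteConfig E, ∏ n ∈ Finset.range M, ∏ k, h ((ω n).2 k) =
      ∏ i : Finset.range M, ∏ k, h ((ω i).2 k) := fun ω =>
    (Finset.prod_coe_sort (Finset.range M) fun n => ∏ k, h ((ω n).2 k)).symm
  simp only [h2]
  rw [h1, Complex.exp_sum, ← Finset.prod_coe_sort (Finset.range M)]
  refine Finset.prod_congr rfl fun i _ => ?_
  rw [← FiniteConfig.integral_prod_exp_sub (hh.mono_measure (Measure.le_sum m i)) hm]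
  exact (measurePreserving_eval_infinitePi (fun n => FiniteConfig.poissonLaw (m n)) i).hasLaw
    |>.integral_comp (FiniteConfig.measurable_prod hm).aestronglyMeasurable

/-- The partial products increase, and by independence their expectations are `exp (∑ ∫ g ∂m n)`,
bounded by `exp (∫ g)`. Monotone convergence passes this bound to the supremum. -/
theorem lintegral_iSup_prod_lt_top {g : E → ℝ} (hm : Measurable g)
    (hg : Integrable g (Measure.sum m)) (h0 : ∀ x, 0 ≤ g x) :
    ∫⁻ ω, ⨆ M, ENNReal.ofReal (∏ n ∈ Finset.range M, ∏ k, (1 + g ((ω n).2 k))) ∂law m < ∞ := by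
  have hp : ∀ b : FiniteConfig E, 1 ≤ ∏ k, (1 + g (b.2 k)) := fun b => by
    calc (1 : ℝ) = ∏ k : Fin b.1, 1 := by simp
      _ ≤ _ := Finset.prod_le_prod (fun _ _ => zero_le_one) fun k _ => by linarith [h0 (b.2 k)]
  have hpm : Measurable fun b : FiniteConfig E => ∏ k, (1 + g (b.2 k)) :=
    FiniteConfig.measurable_prod (hm.const_add 1)
  have hmm : ∀ M, Measurable fun ω : ℕ → FiniteConfig E =>
      ENNReal.ofReal (∏ n ∈ Finset.range M, ∏ k, (1 + g ((ω n).2 k))) := fun M =>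
    (Finset.measurable_fun_prod (Finset.range M) (f := fun n (ω : ℕ → FiniteConfig E) =>
      ∏ k, (1 + g ((ω n).2 k))) fun n _ => hpm.comp (measurable_pi_apply n)).ennreal_ofReal
  rw [lintegral_iSup hmm]
  · refine (iSup_le fun M => ?_).trans_lt
      (ENNReal.ofReal_lt_top (r := Real.exp (∫ x, g x ∂Measure.sum m)))
    have e : ∀ ω : ℕ → FiniteConfig E,
        ENNReal.ofReal (∏ n ∈ Finset.range M, ∏ k, (1 + g ((ω n).2 k))) =
        ∏ n ∈ Finset.range M, ENNReal.ofReal (∏ k, (1 + g ((ω n).2 k))) := fun ω =>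
      ENNReal.ofReal_prod_of_nonneg fun n _ => zero_le_one.trans (hp _)
    simp only [e]
    rw [law, lintegral_prod_eq_prod_lintegral_of_indepFun (Finset.range M)
      (fun n (ω : ℕ → FiniteConfig E) => ENNReal.ofReal (∏ k, (1 + g ((ω n).2 k))))
      (iIndepFun_infinitePi (P := fun n => FiniteConfig.poissonLaw (m n))
        (X := fun _ b => ENNReal.ofReal (∏ k, (1 + g (b.2 k)))) fun _ => hpm.ennreal_ofReal)
      fun n => hpm.ennreal_ofReal.comp (measurable_pi_apply n)]
    have e2 : ∀ n, ∫⁻ ω, ENNReal.ofReal (∏ k, (1 + g ((ω n).2 k))) ∂law m =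
        ENNReal.ofReal (Real.exp (∫ x, g x ∂m n)) := fun n => by
      rw [← FiniteConfig.lintegral_prod_one_add (hg.mono_measure (Measure.le_sum m n)) hm h0]
      exact lintegral_law_eval m n hpm.ennreal_ofReal
    rw [law] at e2
    simp only [e2]
    rw [← ENNReal.ofReal_prod_of_nonneg fun n _ => (Real.exp_pos _).le, ← Real.exp_sum]
    refine ENNReal.ofReal_le_ofReal (Real.exp_le_exp.2 ?_)
    exact sum_le_hasSum _ (fun n _ => integral_nonneg h0) (hasSum_integral_measure hg)
  · refine monotone_nat_of_le_succ fun M ω => ENNReal.ofReal_le_ofReal ?_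
    rw [Finset.prod_range_succ]
    exact le_mul_of_one_le_right (Finset.prod_nonneg fun n _ => zero_le_one.trans (hp _)) (hp _)

/-- The exponential formula for a Poisson point process. -/
theorem exp_integral_count {f : E → ℂ} (hf : Measurable f)
    (hm : Integrable (fun x => Complex.exp (f x) - 1) (Measure.sum m))
    (hint : ∀ᵐ ω ∂law m, Integrable f (count ω)) :
    Integrable (fun ω => Complex.exp (∫ x, f x ∂count ω)) (law m) ∧
      ∫ ω, Complex.exp (∫ x, f x ∂count ω) ∂law m =
        Complex.exp (∫ x, (Complex.exp (f x) - 1) ∂Measure.sum m) := by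
  set h : E → ℂ := fun x => Complex.exp (f x) with hdef
  have hhm : Measurable h := hf.cexp
  set Z : ℕ → (ℕ → FiniteConfig E) → ℂ := fun M ω =>
    ∏ n ∈ Finset.range M, ∏ k, h ((ω n).2 k) with hZ
  have hZm : ∀ M, Measurable (Z M) := fun M =>
    Finset.measurable_fun_prod (Finset.range M) (f := fun n (ω : ℕ → FiniteConfig E) =>
      ∏ k, h ((ω n).2 k)) fun n _ =>
      (FiniteConfig.measurable_prod hhm).comp (measurable_pi_apply n)
  set g : E → ℝ := fun x => ‖h x - 1‖
  have hgm : Measurable g := (hhm.sub_const 1).norm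
  -- Since `|h| ≤ 1 + |h - 1|`, these products dominate `Z`; their supremum `D` is an integrable
  -- majorant independent of `M`.
  set B : ℕ → (ℕ → FiniteConfig E) → ℝ := fun M ω =>
    ∏ n ∈ Finset.range M, ∏ k, (1 + g ((ω n).2 k))
  set D : (ℕ → FiniteConfig E) → ℝ≥0∞ := fun ω => ⨆ M, ENNReal.ofReal (B M ω)
  have hDm : Measurable D := Measurable.iSup fun M =>
    (Finset.measurable_fun_prod (Finset.range M) (f := fun n (ω : ℕ → FiniteConfig E) =>
      ∏ k, (1 + g ((ω n).2 k))) fun n _ =>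
      (FiniteConfig.measurable_prod (hgm.const_add 1)).comp
        (measurable_pi_apply n)).ennreal_ofReal
  have hDfin : ∫⁻ ω, D ω ∂law m < ∞ :=
    lintegral_iSup_prod_lt_top m hgm hm.norm fun x => norm_nonneg _
  have hDint : Integrable (fun ω => (D ω).toReal) (law m) :=
    integrable_toReal_of_lintegral_ne_top hDm.aemeasurable hDfin.ne
  have hZB : ∀ M ω, ‖Z M ω‖ ≤ B M ω := fun M ω => by
    rw [hZ, norm_prod]
    refine Finset.prod_le_prod (fun _ _ => norm_nonneg _) fun n _ => ?_
    rw [norm_prod]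
    refine Finset.prod_le_prod (fun _ _ => norm_nonneg _) fun k _ => ?_
    calc ‖h ((ω n).2 k)‖ = ‖1 + (h ((ω n).2 k) - 1)‖ := by congr 1; ring
      _ ≤ _ := (norm_add_le _ _).trans (by simp [g])
  have hbound : ∀ M, ∀ᵐ ω ∂law m, ‖Z M ω‖ ≤ (D ω).toReal := fun M => by
    filter_upwards [ae_lt_top hDm hDfin.ne] with ω hω
    refine (hZB M ω).trans ?_
    rw [← ENNReal.ofReal_le_iff_le_toReal hω.ne]
    exact le_iSup (fun M => ENNReal.ofReal (B M ω)) M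
  have hlim : ∀ᵐ ω ∂law m, Tendsto (fun M => Z M ω) atTop
      (𝓝 (Complex.exp (∫ x, f x ∂count ω))) := by
    filter_upwards [hint] with ω hω
    have h1 := (hasSum_integral_count hω).tendsto_sum_nat
    refine ((Complex.continuous_exp.tendsto _).comp h1).congr fun M => ?_
    simp only [Function.comp, hZ, hdef, Complex.exp_sum]
  have hL : AEStronglyMeasurable (fun ω => Complex.exp (∫ x, f x ∂count ω)) (law m) :=
    aestronglyMeasurable_of_tendsto_ae atTop (fun M => (hZm M).aestronglyMeasurable) hlim
  refine ⟨hDint.mono' hL ?_, ?_⟩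
  · filter_upwards [hlim, ae_all_iff.2 hbound] with ω h1 h2
    exact le_of_tendsto h1.norm (Eventually.of_forall h2)
  · have h1 := tendsto_integral_of_dominated_convergence _
      (fun M => (hZm M).aestronglyMeasurable) hDint hbound hlim
    refine tendsto_nhds_unique h1 ?_
    have h2 := (hasSum_integral_measure hm).tendsto_sum_nat
    refine ((Complex.continuous_exp.tendsto _).comp h2).congr fun M => ?_
    exact (integrable_range_prod m hhm hm M).symm

end Product

end PoissonProcess

/-! ### Almost sure distinctness of the images of the points. -/

namespace FiniteConfig

variable {E : Type*} [MeasurableSpace E] (m : Measure E) [IsFiniteMeasure m]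

theorem ae_forall_point {p : E → Prop} (hp : ∀ᵐ x ∂m, p x) :
    ∀ᵐ b ∂poissonLaw m, ∀ k, p (b.2 k) := by
  obtain ⟨t, hpt, ht, ht0⟩ := exists_measurable_superset_of_null (ae_iff.1 hp)
  have h := lintegral_sum (m := m) (g := t.indicator 1) (measurable_one.indicator ht)
  rw [lintegral_indicator_one ht, ht0,
    lintegral_eq_zero_iff (measurable_sum (measurable_one.indicator ht))] at h
  filter_upwards [h] with b hb k
  by_contra hk
  have h1 := (Finset.sum_eq_zero_iff.1 hb) k (Finset.mem_univ k)
  simp [show b.2 k ∈ t from hpt hk] at h1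

variable {X : Type*} [MeasurableSpace X] {φ : E → X}

/-- The value of `φ` at the `k`-th point of a configuration, with a default value if there are not
enough points. -/
noncomputable def nthValue [Nonempty X] (φ : E → X) (k : ℕ) (b : FiniteConfig E) : X :=
  if h : k < b.1 then φ (b.2 ⟨k, h⟩) else Classical.arbitrary X

theorem nthValue_coe [Nonempty X] (b : FiniteConfig E) (k : Fin b.1) :
    nthValue φ k b = φ (b.2 k) := by simp [nthValue]

theorem measurable_nthValue [Nonempty X] (hφ : Measurable φ) (k : ℕ) :
    Measurable (nthValue φ k) := by
  refine measurable_sigma_of_mk fun N => ?_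
  by_cases h : k < N
  · simp only [nthValue, h, dite_true]
    exact hφ.comp (measurable_pi_apply (⟨k, h⟩ : Fin N))
  · simp only [nthValue, h, dite_false]
    exact measurable_const

theorem measurable_size : Measurable fun b : FiniteConfig E => b.1 :=
  measurable_sigma_of_mk fun _ => measurable_const

variable [MeasurableEq X] [MeasurableSingletonClass X]

/-- Fubini: once all coordinates but `a` are fixed, a coincidence confines the coordinate `a` to a
single fibre of `φ`, which is null. -/
theorem ae_pi_ne (hφ : Measurable φ) (h0 : ∀ x, m (φ ⁻¹' {x}) = 0) {N : ℕ} {a b : Fin N}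
    (hab : a ≠ b) : ∀ᵐ ξ ∂(Measure.pi fun _ : Fin N => m), φ (ξ a) ≠ φ (ξ b) := by
  rcases N with _ | N
  · exact a.elim0
  obtain ⟨c, rfl⟩ := Fin.exists_succAbove_eq hab.symm
  have hmp := measurePreserving_piFinSuccAbove (fun _ : Fin (N + 1) => m) a
  have hS : MeasurableSet {q : E × (Fin N → E) | φ q.1 = φ (q.2 c)} :=
    measurableSet_eq_fun (hφ.comp measurable_fst)
      (hφ.comp ((measurable_pi_apply c).comp measurable_snd))
  have hnull : (m.prod (Measure.pi fun _ : Fin N => m)) {q | φ q.1 = φ (q.2 c)} = 0 := by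
    rw [Measure.prod_apply_symm hS]
    refine (lintegral_congr fun ζ => ?_).trans lintegral_zero
    exact h0 (φ (ζ c))
  have h := hmp.measure_preimage hS.nullMeasurableSet
  rw [hnull] at h
  rw [ae_iff]
  simp only [ne_eq, not_not]
  exact h

theorem ae_injective (hφ : Measurable φ) (h0 : ∀ x, m (φ ⁻¹' {x}) = 0) :
    ∀ᵐ b ∂poissonLaw m, Function.Injective fun k => φ (b.2 k) := by
  have hS : MeasurableSet {b : FiniteConfig E | Function.Injective fun k => φ (b.2 k)} := by
    refine MeasurableSpace.measurableSet_iInf.2 fun N => ?_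
    change MeasurableSet {ξ : Fin N → E | ∀ a b, φ (ξ a) = φ (ξ b) → a = b}
    simp only [ofPred_forall]
    refine MeasurableSet.iInter fun a => MeasurableSet.iInter fun b => ?_
    exact (measurableSet_eq_fun (hφ.comp (measurable_pi_apply a))
      (hφ.comp (measurable_pi_apply b))).imp (MeasurableSet.const (a = b))
  rw [poissonLaw, Measure.ae_sum_iff]
  refine fun N => Measure.ae_smul_measure ?_ _
  rw [ae_map_iff (measurable_sigmaMk N).aemeasurable hS]
  have : ∀ᵐ ξ ∂(Measure.pi fun _ : Fin N => m), ∀ a b, a ≠ b → φ (ξ a) ≠ φ (ξ b) := by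
    refine ae_all_iff.2 fun a => ae_all_iff.2 fun b => ?_
    by_cases hab : a = b
    · simp [hab]
    · exact (ae_pi_ne m hφ h0 hab).mono fun _ h _ => h
  filter_upwards [this] with ξ hξ a b hab
  by_contra h
  exact hξ a b h hab

theorem ae_prod_ne [Nonempty X] (m' : Measure E) [IsFiniteMeasure m'] (hφ : Measurable φ)
    (h0 : ∀ x, m' (φ ⁻¹' {x}) = 0) :
    ∀ᵐ p ∂(poissonLaw m).prod (poissonLaw m'), ∀ k k', φ (p.1.2 k) ≠ φ (p.2.2 k') := by
  -- Only `k'` has to be in range. The default value of `nthValue φ k p.1` is harmless, because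
  -- every fibre of `φ` is null for `m'`, whatever point it lies over.
  have h : ∀ k k' : ℕ, ∀ᵐ p ∂(poissonLaw m).prod (poissonLaw m'),
      ¬ (k' < p.2.1 ∧ nthValue φ k p.1 = nthValue φ k' p.2) := by
    intro k k'
    have hS : MeasurableSet {p : FiniteConfig E × FiniteConfig E |
        k' < p.2.1 ∧ nthValue φ k p.1 = nthValue φ k' p.2} :=
      (measurableSet_lt measurable_const (measurable_size.comp measurable_snd)).inter
        (measurableSet_eq_fun ((measurable_nthValue hφ k).comp measurable_fst)
          ((measurable_nthValue hφ k').comp measurable_snd))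
    rw [ae_iff]
    simp only [not_not]
    rw [Measure.measure_prod_null hS]
    refine Eventually.of_forall fun b => ?_
    have hp : ∀ᵐ x ∂m', φ x ≠ nthValue φ k b := by
      rw [ae_iff]
      simp only [ne_eq, not_not]
      exact h0 _
    refine measure_mono_null ?_ (ae_iff.1 (ae_forall_point m' hp))
    rintro b' ⟨hk', he⟩ hall
    refine hall ⟨k', hk'⟩ ?_
    rw [he, ← nthValue_coe (φ := φ)]
  filter_upwards [ae_all_iff.2 fun k => ae_all_iff.2 (h k)] with p hp k k' he
  refine hp k k' ⟨k'.2, ?_⟩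
  rw [nthValue_coe, nthValue_coe, he]

end FiniteConfig

namespace PoissonProcess

variable {E X : Type*} [MeasurableSpace E] [MeasurableSpace X] [MeasurableEq X]
  [MeasurableSingletonClass X] (m : ℕ → Measure E) [∀ n, IsFiniteMeasure (m n)]

/-- The images of the points of a Poisson process under a map whose fibres have intensity zero are
almost surely distinct. -/
theorem ae_injective_point {φ : E → X} (hφ : Measurable φ)
    (h0 : ∀ x, Measure.sum m (φ ⁻¹' {x}) = 0) :
    ∀ᵐ ω ∂law m, Function.Injective fun i : Index ω => φ (point ω i) := by
  rcases isEmpty_or_nonempty X with hX | hX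
  · exact Eventually.of_forall fun ω i => hX.elim (φ (point ω i))
  have h0' : ∀ n x, m n (φ ⁻¹' {x}) = 0 := fun n x =>
    le_antisymm ((Measure.le_sum m n _).trans (h0 x).le) zero_le
  have h1 : ∀ n, ∀ᵐ ω ∂law m, Function.Injective fun k => φ ((ω n).2 k) := fun n =>
    (measurePreserving_eval_infinitePi (fun n => FiniteConfig.poissonLaw (m n)) n
      ).quasiMeasurePreserving.ae (FiniteConfig.ae_injective (m n) hφ (h0' n))
  have h2 : ∀ n n', n ≠ n' → ∀ᵐ ω ∂law m, ∀ k k', φ ((ω n).2 k) ≠ φ ((ω n').2 k') := by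
    intro n n' hn
    have hmap := Measure.infinitePi_map_eval_prod
      (P := fun n => FiniteConfig.poissonLaw (m n)) hn
    have hae := FiniteConfig.ae_prod_ne (m n) (m n') hφ (h0' n')
    rw [← hmap] at hae
    exact ae_of_ae_map
      ((measurable_pi_apply n).prodMk (measurable_pi_apply n')).aemeasurable hae
  have h2' : ∀ᵐ ω ∂law m, ∀ n n', n ≠ n' → ∀ k k', φ ((ω n).2 k) ≠ φ ((ω n').2 k') := by
    refine ae_all_iff.2 fun n => ae_all_iff.2 fun n' => ?_
    by_cases hn : n = n'
    · simp [hn]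
    · exact (h2 n n' hn).mono fun _ h _ => h
  filter_upwards [ae_all_iff.2 h1, h2'] with ω hω1 hω2
  rintro ⟨n, k⟩ ⟨n', k'⟩ h
  by_cases hn : n = n'
  · subst hn
    exact congrArg _ (hω1 n h)
  · exact absurd h (hω2 n n' hn k k')

end PoissonProcess

/-! ### Sums over the pairs (atom, weight) of a Radon measure. -/

namespace RadonMeasure

/-- A measure which is finite on compact sets, as a Radon measure. -/
def ofMeasure {X : Type*} [TopologicalSpace X] [MeasurableSpace X] (η : Measure X)
    (h : ∀ K : Set X, IsCompact K → η K < ∞) : RadonMeasure X := ⟨η, h⟩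

variable {X : Type*} [TopologicalSpace X] [LocallyCompactSpace X] [PolishSpace X]
  [MeasurableSpace X] [BorelSpace X]

/-- The measure is carried by its listed atoms, and each term of the sum bounds the mass of its own
atom from below by a positive number. -/
theorem ae_weight_pos {η : RadonMeasure X} (h : η ∈ discreteRadon X) :
    ∀ᵐ x ∂η.1, 0 < η.weight x := by
  obtain ⟨T, s, hT, hs, hη⟩ := h
  have : Countable T := hT
  have hw : ∀ x : T, 0 < η.weight x := fun x => by
    refine ENNReal.toReal_pos (fun h0 => ?_) (η.measure_singleton_ne_top _)
    rw [hη] at h0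
    have h1 := (Measure.le_sum (fun x : T => ENNReal.ofReal (s x) • Measure.dirac (x : X)) x
      {(x : X)}).trans h0.le
    simp only [Measure.smul_apply, measurableSet_singleton, Measure.dirac_apply', mem_singleton_iff,
      indicator_of_mem, Pi.one_apply, smul_eq_mul, mul_one, nonpos_iff_eq_zero,
      ENNReal.ofReal_eq_zero] at h1
    exact absurd (hs x x.2) (not_lt.2 h1)
  have h2 : ∀ᵐ x ∂(Measure.sum fun x : T => ENNReal.ofReal (s x) • Measure.dirac (x : X)),
      0 < η.weight x := by
    rw [Measure.ae_sum_iff]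
    refine fun x => Measure.ae_smul_measure ?_ _
    rw [ae_dirac_eq]
    exact hw x
  rwa [← hη] at h2

/-- The function whose integral against a discrete Radon measure is the sum of the values of `f` at
the pairs (atom, weight). -/
noncomputable def marked (f : X × ℝ → ℂ) (η : RadonMeasure X) (x : X) : ℂ :=
  (η.weight x)⁻¹ • f (x, η.weight x)

theorem measurable_marked {f : X × ℝ → ℂ} (hf : Measurable f) :
    Measurable (Function.uncurry (marked f)) :=
  measurable_weight_prod.inv.smul (hf.comp (measurable_snd.prodMk measurable_weight_prod))

theorem measurable_marked_right {f : X × ℝ → ℂ} (hf : Measurable f) (η : RadonMeasure X) :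
    Measurable (marked f η) :=
  (measurable_weight η).inv.smul (hf.comp (measurable_id.prodMk (measurable_weight η)))

theorem measurableSet_integrable_marked {f : X × ℝ → ℂ} (hf : Measurable f) :
    MeasurableSet {η : RadonMeasure X | Integrable (marked f η) η.1} :=
  measurableSet_kernel_integrable (κ := kernel X) (measurable_marked hf).stronglyMeasurable

theorem measurable_integral_marked {f : X × ℝ → ℂ} (hf : Measurable f) :
    Measurable fun η : RadonMeasure X => ∫ x, marked f η x ∂η.1 :=
  (StronglyMeasurable.integral_kernel_prod_right (κ := kernel X)
    (measurable_marked hf).stronglyMeasurable).measurable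

end RadonMeasure

/-- The conditions on a measure on `X × ℝ` under which it is the Lévy measure of a random discrete
Radon measure without fixed atoms. -/
structure IsLevyIntensity {X : Type*} [TopologicalSpace X] [MeasurableSpace X]
    (M : Measure (X × ℝ)) : Prop where
  pos : ∀ᵐ p ∂M, 0 < p.2
  fin : ∀ K : Set X, IsCompact K → ∫⁻ p in K ×ˢ univ, ENNReal.ofReal (min p.2 1) ∂M < ∞
  fibre : ∀ x, M (Prod.fst ⁻¹' {x}) = 0

/-! ### The random discrete measure built from Poisson points in X × ℝ. -/

namespace PoissonProcess

variable {X : Type*} [TopologicalSpace X] [LocallyCompactSpace X] [PolishSpace X]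
  [MeasurableSpace X] [BorelSpace X]

/-- The measure with atoms at the first coordinates of the points and weights given by the second
coordinates. -/
noncomputable def weighted (ω : ℕ → FiniteConfig (X × ℝ)) : Measure X :=
  ((count ω).withDensity fun p => ENNReal.ofReal p.2).map Prod.fst

omit [LocallyCompactSpace X] [PolishSpace X] [BorelSpace X] [TopologicalSpace X] in
theorem lintegral_weighted (ω : ℕ → FiniteConfig (X × ℝ)) {g : X → ℝ≥0∞} (hg : Measurable g) :
    ∫⁻ x, g x ∂weighted ω = ∫⁻ p, ENNReal.ofReal p.2 * g p.1 ∂count ω := by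
  rw [weighted, lintegral_map hg measurable_fst]
  exact lintegral_withDensity_eq_lintegral_mul _ measurable_snd.ennreal_ofReal
    (hg.comp measurable_fst)

omit [LocallyCompactSpace X] [PolishSpace X] [BorelSpace X] [TopologicalSpace X] in
theorem weighted_apply (ω : ℕ → FiniteConfig (X × ℝ)) {A : Set X} (hA : MeasurableSet A) :
    weighted ω A = ∫⁻ p, ENNReal.ofReal p.2 * A.indicator 1 p.1 ∂count ω := by
  rw [← lintegral_weighted ω (measurable_one.indicator hA), lintegral_indicator_one hA]

omit [LocallyCompactSpace X] [PolishSpace X] [BorelSpace X] [TopologicalSpace X] in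
theorem measurable_weighted :
    Measurable (weighted : (ℕ → FiniteConfig (X × ℝ)) → Measure X) := by
  refine Measure.measurable_of_measurable_coe _ fun A hA => ?_
  simp only [weighted_apply _ hA]
  exact measurable_lintegral_count (measurable_snd.ennreal_ofReal.mul
    ((measurable_one.indicator hA).comp measurable_fst))

/-- The configurations for which the associated weighted measure is finite on compact sets. -/
def good (X : Type*) [TopologicalSpace X] [LocallyCompactSpace X] [PolishSpace X]
    [MeasurableSpace X] : Set (ℕ → FiniteConfig (X × ℝ)) :=
  {ω | ∀ n, weighted ω ((default : CompactExhaustion X) n) < ∞}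

theorem measurableSet_good : MeasurableSet (good X) := by
  simp only [good, ofPred_forall]
  exact MeasurableSet.iInter fun n => measurableSet_lt
    (Measure.measurable_measure.1 measurable_weighted _
      (CompactExhaustion.isCompact _ n).measurableSet) measurable_const

open Classical in
/-- The Radon measure associated with a configuration of points in `X × ℝ`. -/
noncomputable def toRadon (ω : ℕ → FiniteConfig (X × ℝ)) : RadonMeasure X :=
  if h : ω ∈ good X then RadonMeasure.ofMeasure (weighted ω) fun K hK => by
    obtain ⟨n, hn⟩ := (default : CompactExhaustion X).exists_superset_of_isCompact hK
    exact (measure_mono hn).trans_lt (h n)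
  -- An arbitrary value: the good configurations have full measure by `ae_mem_good`.
  else RadonMeasure.ofMeasure 0 fun _ _ => by simp

theorem toRadon_val {ω : ℕ → FiniteConfig (X × ℝ)} (h : ω ∈ good X) :
    (toRadon ω).1 = weighted ω := by
  rw [toRadon, dif_pos h]
  rfl

theorem measurable_toRadon : Measurable (toRadon (X := X)) := by
  classical
  rw [RadonMeasure.measurable_iff_val]
  have : (fun ω => (toRadon (X := X) ω).1) = fun ω => if ω ∈ good X then weighted ω else 0 := by
    funext ω
    by_cases h : ω ∈ good X
    · rw [toRadon_val h, if_pos h]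
    · rw [toRadon, dif_neg h, if_neg h]
      rfl
  rw [this]
  exact Measurable.ite measurableSet_good measurable_weighted measurable_const

section Simple

variable {ω : ℕ → FiniteConfig (X × ℝ)} (hg : ω ∈ good X) (hpos : ∀ i, 0 < (point ω i).2)
  (hinj : Function.Injective fun i : Index ω => (point ω i).1)

include hg hpos hinj

/-- As the first coordinates are distinct, only the point `i` contributes mass to its own location,
so the marks can be read off the measure. -/
theorem weight_point (i : Index ω) : (toRadon ω).weight (point ω i).1 = (point ω i).2 := by
  have hm : Measurable fun p : X × ℝ =>
      ENNReal.ofReal p.2 * ({(point ω i).1} : Set X).indicator 1 p.1 :=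
    measurable_snd.ennreal_ofReal.mul
      ((measurable_one.indicator (measurableSet_singleton _)).comp measurable_fst)
  rw [RadonMeasure.weight, measureReal_def, toRadon_val hg,
    weighted_apply ω (measurableSet_singleton _), count, lintegral_sum_measure]
  simp only [lintegral_dirac' _ hm]
  rw [tsum_eq_single i]
  · simp [ENNReal.toReal_ofReal (hpos i).le]
  · intro j hj
    have : (point ω j).1 ≠ (point ω i).1 := fun h => hj (hinj h)
    simp [this]

theorem ae_count_weight : ∀ᵐ p ∂count ω, (toRadon ω).weight p.1 = p.2 :=
  ae_count_iff.2 (weight_point hg hpos hinj)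

/-- Every point of the configuration sits over an atom, so the set of non-atoms receives no mass. -/
theorem diffuse_eq_zero : (toRadon ω).1 {x | (toRadon ω).1 {x} = 0} = 0 := by
  have hm : MeasurableSet {x | (toRadon ω).1 {x} = 0} :=
    (RadonMeasure.measurable_singleton_prod.comp measurable_prodMk_left)
      (measurableSet_singleton 0)
  have hae : ∀ᵐ p ∂count ω, p.1 ∉ {x | (toRadon ω).1 {x} = 0} := by
    refine ae_count_iff.2 fun i h => ?_
    have h1 := weight_point hg hpos hinj i
    have h0 : (toRadon ω).1 {(point ω i).1} = 0 := h
    rw [RadonMeasure.weight, measureReal_def, h0] at h1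
    exact (hpos i).ne h1
  have hval := congrArg (fun κ : Measure X => κ {x | (toRadon ω).1 {x} = 0}) (toRadon_val hg)
  refine hval.trans ?_
  rw [weighted_apply ω hm]
  refine (lintegral_congr_ae ?_).trans lintegral_zero
  filter_upwards [hae] with p hp
  have h0 := indicator_of_notMem (s := {x | (toRadon ω).1 {x} = 0}) hp (1 : X → ℝ≥0∞)
  rw [h0, mul_zero]

omit hpos hinj in
theorem integrable_toRadon_iff {F : X → ℂ} (hF : Measurable F) :
    Integrable F (toRadon ω).1 ↔
      Integrable (fun p => (ENNReal.ofReal p.2).toReal • F p.1) (count ω) := by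
  rw [toRadon_val hg, weighted, integrable_map_measure hF.aestronglyMeasurable
    measurable_fst.aemeasurable, integrable_withDensity_iff_integrable_smul'
    measurable_snd.ennreal_ofReal (Eventually.of_forall fun _ => ENNReal.ofReal_lt_top)]
  rfl

omit hpos hinj in
theorem integral_toRadon {F : X → ℂ} (hF : Measurable F) :
    ∫ x, F x ∂(toRadon ω).1 = ∫ p, (ENNReal.ofReal p.2).toReal • F p.1 ∂count ω := by
  rw [toRadon_val hg, weighted, integral_map measurable_fst.aemeasurable hF.aestronglyMeasurable,
    integral_withDensity_eq_integral_toReal_smul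
    measurable_snd.ennreal_ofReal (Eventually.of_forall fun _ => ENNReal.ofReal_lt_top)]

/-- The weight `s` carried by the measure cancels the factor `s⁻¹` in `marked`. This turns integrals
against the random measure into sums over Poisson points. -/
theorem ae_smul_marked (f : X × ℝ → ℂ) :
    (fun p : X × ℝ => (ENNReal.ofReal p.2).toReal • RadonMeasure.marked f (toRadon ω) p.1)
      =ᵐ[count ω] f := by
  filter_upwards [ae_count_weight hg hpos hinj, (ae_count_iff (p := fun p => 0 < p.2)).2 hpos] with p h1 h2
  rw [RadonMeasure.marked, h1, ENNReal.toReal_ofReal h2.le, smul_smul, mul_inv_cancel₀ h2.ne',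
    one_smul]

theorem integrable_marked_iff {f : X × ℝ → ℂ} (hf : Measurable f) :
    Integrable (RadonMeasure.marked f (toRadon ω)) (toRadon ω).1 ↔ Integrable f (count ω) := by
  rw [integrable_toRadon_iff hg (RadonMeasure.measurable_marked_right hf _)]
  exact integrable_congr (ae_smul_marked hg hpos hinj f)

theorem integral_marked {f : X × ℝ → ℂ} (hf : Measurable f) :
    ∫ x, RadonMeasure.marked f (toRadon ω) x ∂(toRadon ω).1 = ∫ p, f p ∂count ω := by
  rw [integral_toRadon hg (RadonMeasure.measurable_marked_right hf _)]
  exact integral_congr_ae (ae_smul_marked hg hpos hinj f)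

end Simple

/-- The mass of a compact set is the sum of the marks over it, and its convergence needs only
integrability of `min s 1`: almost surely only finitely many marks over a compact set exceed `1`. -/
theorem ae_mem_good (m : ℕ → Measure (X × ℝ)) [∀ n, IsFiniteMeasure (m n)]
    (hM : IsLevyIntensity (Measure.sum m)) : ∀ᵐ ω ∂law m, ω ∈ good X := by
  refine ae_all_iff.2 fun n => ?_
  set K : Set X := (default : CompactExhaustion X) n
  have hK : IsCompact K := (default : CompactExhaustion X).isCompact n
  have hKm := hK.measurableSet
  have hf : Measurable ((K ×ˢ univ).indicator fun p : X × ℝ => p.2) :=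
    measurable_snd.indicator (hKm.prod MeasurableSet.univ)
  have hfin : ∫⁻ p, min ‖(K ×ˢ univ).indicator (fun p : X × ℝ => p.2) p‖ₑ 1 ∂Measure.sum m < ∞ := by
    refine lt_of_eq_of_lt ?_ (hM.fin K hK)
    rw [← lintegral_indicator (hKm.prod MeasurableSet.univ)]
    refine lintegral_congr_ae ?_
    filter_upwards [hM.pos] with p hp
    by_cases h : p ∈ K ×ˢ (univ : Set ℝ)
    · rw [indicator_of_mem h, indicator_of_mem h, ENNReal.ofReal_min, ENNReal.ofReal_one,
        Real.enorm_of_nonneg hp.le]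
    · rw [indicator_of_notMem h, indicator_of_notMem h]
      simp
  filter_upwards [ae_integrable_count m hf hfin, ae_forall_point m hM.pos] with ω h1 h2
  rw [weighted_apply ω hKm]
  refine lt_of_eq_of_lt (lintegral_congr_ae ?_) h1.2
  filter_upwards [(ae_count_iff (p := fun p => 0 < p.2)).2 h2] with p hp
  by_cases h : p.1 ∈ K
  · rw [indicator_of_mem h, indicator_of_mem (by simpa using h), Real.enorm_of_nonneg hp.le]
    simp
  · rw [indicator_of_notMem h, indicator_of_notMem (by simpa using h)]
    simp

end PoissonProcess

/-- `μ` is the law of a random discrete Radon measure whose pairs (atom, weight) form a Poisson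
process with intensity `M`, expressed through the exponential formula for sums over the atoms. -/
structure HasPoissonMarks {X : Type*} [TopologicalSpace X] [LocallyCompactSpace X]
    [PolishSpace X] [MeasurableSpace X] [BorelSpace X] (M : Measure (X × ℝ))
    (μ : Measure (RadonMeasure X)) : Prop where
  isProbabilityMeasure : IsProbabilityMeasure μ
  discrete : ∀ᵐ η ∂μ, η ∈ discreteRadon X
  ae_integrable : ∀ f : X × ℝ → ℂ, Measurable f → ∫⁻ p, min ‖f p‖ₑ 1 ∂M < ∞ →
    ∀ᵐ η ∂μ, Integrable (RadonMeasure.marked f η) η.1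
  integrable_exp : ∀ f : X × ℝ → ℂ, Measurable f → ∫⁻ p, min ‖f p‖ₑ 1 ∂M < ∞ →
    Integrable (fun p => Complex.exp (f p) - 1) M →
    Integrable (fun η : RadonMeasure X => Complex.exp (∫ x, RadonMeasure.marked f η x ∂η.1)) μ
  integral_exp : ∀ f : X × ℝ → ℂ, Measurable f → ∫⁻ p, min ‖f p‖ₑ 1 ∂M < ∞ →
    Integrable (fun p => Complex.exp (f p) - 1) M →
    ∫ η : RadonMeasure X, Complex.exp (∫ x, RadonMeasure.marked f η x ∂η.1) ∂μ =
      Complex.exp (∫ p, (Complex.exp (f p) - 1) ∂M)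

open PoissonProcess in
/-- Existence of a random discrete Radon measure with given Lévy measure. -/
theorem IsLevyIntensity.exists_hasPoissonMarks {X : Type*} [TopologicalSpace X]
    [LocallyCompactSpace X] [PolishSpace X] [MeasurableSpace X] [BorelSpace X]
    {M : Measure (X × ℝ)} [SFinite M] (hM : IsLevyIntensity M) :
    ∃ μ : Measure (RadonMeasure X), HasPoissonMarks M μ := by
  -- The intensity is cut into countably many finite pieces, each supplying an independent finite
  -- Poisson configuration.
  obtain ⟨m, hm, hMm⟩ : ∃ m : ℕ → Measure (X × ℝ), (∀ n, IsFiniteMeasure (m n)) ∧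
      M = Measure.sum m := ⟨sfiniteSeq M, inferInstance, (sum_sfiniteSeq M).symm⟩
  rw [hMm] at hM ⊢
  have hfib := ae_injective_point m measurable_fst hM.fibre
  have hpos := ae_forall_point m hM.pos
  have hgood := ae_mem_good m hM
  have hΦ := measurable_toRadon (X := X)
  have hmeas : ∀ f : X × ℝ → ℂ, Measurable f → Measurable fun η : RadonMeasure X =>
      Complex.exp (∫ x, RadonMeasure.marked f η x ∂η.1) := fun f hf =>
    (RadonMeasure.measurable_integral_marked hf).cexp
  have he : ∀ f : X × ℝ → ℂ, Measurable f →
      (fun ω => Complex.exp (∫ x, RadonMeasure.marked f (toRadon ω) x ∂(toRadon ω).1))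
        =ᵐ[law m] fun ω => Complex.exp (∫ p, f p ∂count ω) := fun f hf => by
    filter_upwards [hfib, hpos, hgood] with ω h1 h2 h3
    rw [integral_marked h3 h2 h1 hf]
  refine ⟨(law m).map toRadon, Measure.isProbabilityMeasure_map hΦ.aemeasurable, ?_, ?_, ?_, ?_⟩
  · refine RadonMeasure.ae_map_mem_discreteRadon hΦ ?_
    filter_upwards [hfib, hpos, hgood] with ω h1 h2 h3
    exact diffuse_eq_zero h3 h2 h1
  · intro f hf hmin
    rw [ae_map_iff hΦ.aemeasurable (RadonMeasure.measurableSet_integrable_marked hf)]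
    filter_upwards [hfib, hpos, hgood, ae_integrable_count m hf hmin] with ω h1 h2 h3 h4
    exact (integrable_marked_iff h3 h2 h1 hf).2 h4
  · intro f hf hmin hexp
    rw [integrable_map_measure (hmeas f hf).aestronglyMeasurable hΦ.aemeasurable]
    exact (exp_integral_count m hf hexp (ae_integrable_count m hf hmin)).1.congr (he f hf).symm
  · intro f hf hmin hexp
    rw [integral_map hΦ.aemeasurable (hmeas f hf).aestronglyMeasurable,
      ← (exp_integral_count m hf hexp (ae_integrable_count m hf hmin)).2]
    exact integral_congr_ae (he f hf)

/-! ### Fourier functional, complete randomness and uniqueness. -/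

section

variable {X : Type*} [TopologicalSpace X] [LocallyCompactSpace X] [PolishSpace X]
  [MeasurableSpace X] [BorelSpace X]

namespace RadonMeasure

/-- At an atom the factor `s` cancels `s⁻¹`, so ordinary integrals of `g` are sums over pairs. The
extra term `f` is what later carries the logarithm of the density. -/
theorem marked_mul_ae {η : RadonMeasure X} (h : η ∈ discreteRadon X) (g : X → ℝ)
    (f : X × ℝ → ℂ) :
    marked (fun p => Complex.I * ((p.2 * g p.1 : ℝ) : ℂ) + f p) η =ᵐ[η.1]
      fun x => Complex.I * (g x : ℂ) + marked f η x := by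
  filter_upwards [ae_weight_pos h] with x hx
  have hx' : (η.weight x : ℂ) ≠ 0 := by exact_mod_cast hx.ne'
  simp only [marked, smul_add, Complex.real_smul]
  push_cast
  field_simp

end RadonMeasure

namespace IsLevyIntensity

variable {M : Measure (X × ℝ)} (hM : IsLevyIntensity M)

theorem _root_.min_mul_one_le {C s : ℝ} (hC : 1 ≤ C) :
    min (s * C) 1 ≤ C * min s 1 := by
  rcases le_total s 1 with h | h
  · rw [min_eq_left h, mul_comm]
    exact min_le_left _ _
  · rw [min_eq_right h, mul_one]
    exact (min_le_right _ _).trans hC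

include hM

theorem lintegral_indicator_min_lt_top {K : Set X} (hK : IsCompact K) {C : ℝ} (hC : 0 ≤ C) :
    ∫⁻ p, ENNReal.ofReal ((K ×ˢ univ).indicator (fun p : X × ℝ => C * min p.2 1) p) ∂M < ∞ := by
  have hKm : MeasurableSet (K ×ˢ (univ : Set ℝ)) := hK.measurableSet.prod MeasurableSet.univ
  have e : ∀ p : X × ℝ, ENNReal.ofReal ((K ×ˢ univ).indicator (fun p : X × ℝ => C * min p.2 1) p) =
      (K ×ˢ univ).indicator (fun p : X × ℝ => ENNReal.ofReal C * ENNReal.ofReal (min p.2 1)) p := by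
    intro p
    by_cases h : p ∈ K ×ˢ (univ : Set ℝ)
    · rw [indicator_of_mem h, indicator_of_mem h, ENNReal.ofReal_mul hC]
    · rw [indicator_of_notMem h, indicator_of_notMem h, ENNReal.ofReal_zero]
  simp only [e]
  rw [lintegral_indicator hKm, lintegral_const_mul' _ _ ENNReal.ofReal_ne_top]
  exact ENNReal.mul_lt_top ENNReal.ofReal_lt_top (hM.fin K hK)

section Bounded

variable {g : X → ℝ} {K : Set X} {C : ℝ}
  (hg : Measurable g) (hK : IsCompact K) (hgK : ∀ x, x ∉ K → g x = 0) (hgC : ∀ x, |g x| ≤ C)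
include hg hK hgK hgC

omit [LocallyCompactSpace X] [PolishSpace X] [BorelSpace X] hg hK in
theorem ae_min_mul_le : ∀ᵐ p ∂M, min |p.2 * g p.1| 1 ≤
    (K ×ˢ univ).indicator (fun p : X × ℝ => max C 1 * min p.2 1) p := by
  filter_upwards [hM.pos] with p hp
  by_cases h : p.1 ∈ K
  · rw [indicator_of_mem (by simpa using h), abs_mul, abs_of_pos hp]
    refine le_trans (min_le_min_right _ ?_) (min_mul_one_le (le_max_right C 1))
    exact mul_le_mul_of_nonneg_left ((hgC _).trans (le_max_left _ _)) hp.le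
  · rw [indicator_of_notMem (by simpa using h), hgK _ h]
    simp

theorem lintegral_min_mul_lt_top : ∫⁻ p, min ‖p.2 * g p.1‖ₑ 1 ∂M < ∞ := by
  refine lt_of_le_of_lt (lintegral_mono_ae ?_)
    (hM.lintegral_indicator_min_lt_top hK (C := max C 1) (by positivity))
  filter_upwards [hM.ae_min_mul_le hgK hgC] with p hp
  rw [← ofReal_norm, Real.norm_eq_abs, ← ENNReal.ofReal_one, ← ENNReal.ofReal_min]
  exact ENNReal.ofReal_le_ofReal hp

/-- The bound `|e^{it} - 1| ≤ 2 min(|t|, 1)` reduces this to the integrability of `min s 1` over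
compact sets. -/
theorem integrable_exp_sub_one :
    Integrable (fun p => Complex.exp (Complex.I * ((p.2 * g p.1 : ℝ) : ℂ)) - 1) M := by
  have hm : Measurable fun p : X × ℝ => Complex.exp (Complex.I * ((p.2 * g p.1 : ℝ) : ℂ)) - 1 :=
    (((Complex.measurable_ofReal.comp (measurable_snd.mul (hg.comp measurable_fst))).const_mul
      Complex.I).cexp).sub_const 1
  refine ⟨hm.aestronglyMeasurable, ?_⟩
  refine lt_of_le_of_lt (lintegral_mono_ae (g := fun p => 2 * min ‖p.2 * g p.1‖ₑ 1) ?_) ?_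
  · refine Eventually.of_forall fun p => ?_
    rw [← ofReal_norm, ← ofReal_norm, ← ENNReal.ofReal_one,
      ← ENNReal.ofReal_min, ← ENNReal.ofReal_ofNat, ← ENNReal.ofReal_mul (by norm_num)]
    refine ENNReal.ofReal_le_ofReal ?_
    rw [mul_min_of_nonneg _ _ (by norm_num)]
    refine le_min ?_ ?_
    · refine (Real.norm_exp_I_mul_ofReal_sub_one_le).trans ?_
      linarith [norm_nonneg (p.2 * g p.1)]
    · refine (norm_sub_le _ _).trans ?_
      rw [Complex.norm_exp_I_mul_ofReal, norm_one]
      norm_num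
  · rw [lintegral_const_mul' _ _ (by norm_num)]
    exact ENNReal.mul_lt_top (by norm_num) (hM.lintegral_min_mul_lt_top hg hK hgK hgC)

end Bounded

end IsLevyIntensity

namespace HasPoissonMarks

variable {M : Measure (X × ℝ)} (hM : IsLevyIntensity M) {μ : Measure (RadonMeasure X)}
  (hμ : HasPoissonMarks M μ)
include hM hμ

/-- Continuity of `g` is not required, so that combinations of indicators of bounded Borel sets are
allowed in the proof of independence. -/
theorem fourier_of_bounded {g : X → ℝ} {K : Set X} {C : ℝ} (hg : Measurable g) (hK : IsCompact K)
    (hgK : ∀ x, x ∉ K → g x = 0) (hgC : ∀ x, |g x| ≤ C) :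
    ∫ η : RadonMeasure X, Complex.exp (Complex.I * ((∫ x, g x ∂η.1 : ℝ) : ℂ)) ∂μ =
      Complex.exp (∫ p, (Complex.exp (Complex.I * ((p.2 * g p.1 : ℝ) : ℂ)) - 1) ∂M) := by
  have hm : Measurable fun p : X × ℝ => Complex.I * ((p.2 * g p.1 : ℝ) : ℂ) :=
    (Complex.measurable_ofReal.comp (measurable_snd.mul (hg.comp measurable_fst))).const_mul _
  have hmin : ∫⁻ p : X × ℝ, min ‖Complex.I * ((p.2 * g p.1 : ℝ) : ℂ)‖ₑ 1 ∂M < ∞ := by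
    have := hM.lintegral_min_mul_lt_top hg hK hgK hgC
    have e : ∀ p : X × ℝ, ‖Complex.I * ((p.2 * g p.1 : ℝ) : ℂ)‖ₑ = ‖p.2 * g p.1‖ₑ := fun p => by
      rw [← ofReal_norm, ← ofReal_norm, norm_mul, Complex.norm_I, one_mul, Complex.norm_real]
    simpa only [e] using this
  rw [← hμ.integral_exp _ hm hmin (hM.integrable_exp_sub_one hg hK hgK hgC)]
  refine integral_congr_ae ?_
  filter_upwards [hμ.discrete] with η hη
  have h := RadonMeasure.marked_mul_ae hη g 0
  have h0 : RadonMeasure.marked 0 η = 0 := by funext x; simp [RadonMeasure.marked]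
  simp only [h0, Pi.zero_apply, add_zero] at h
  rw [integral_congr_ae h, integral_const_mul, integral_complex_ofReal]

/-- Independence is the factorization of the joint characteristic function, which is the Fourier
functional at `∑ t i • 1_{A i}`. -/
theorem iIndepFun_real {n : ℕ} {A : Fin n → Set X} (hA : ∀ i, IsBoundedBorel (A i))
    (hd : Pairwise fun i j => Disjoint (A i) (A j)) :
    iIndepFun (fun (i : Fin n) (η : RadonMeasure X) => η.1.real (A i)) μ := by
  have := hμ.isProbabilityMeasure
  have hXm : ∀ i, Measurable fun η : RadonMeasure X => η.1.real (A i) := fun i =>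
    (RadonMeasure.measurable_coe (hA i).1).ennreal_toReal
  have hAfin : ∀ i (η : RadonMeasure X), η.1 (A i) ≠ ∞ := fun i η =>
    ((measure_mono subset_closure).trans_lt (η.2 _ (hA i).2)).ne
  have hint : ∀ i (η : RadonMeasure X) (c : ℝ), Integrable ((A i).indicator fun _ => c) η.1 :=
    fun i η c => (integrable_indicator_iff (hA i).1).2 (integrableOn_const (hAfin i η))
  let g : Fin n → ℝ → X → ℝ := fun i c => (A i).indicator fun _ => c
  have hgm : ∀ i c, Measurable (g i c) := fun i c => measurable_const.indicator (hA i).1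
  have hgi : ∀ i c (η : RadonMeasure X), ∫ x, g i c x ∂η.1 = η.1.real (A i) * c := fun i c η => by
    simp only [g]
    rw [integral_indicator (hA i).1, setIntegral_const, smul_eq_mul]
  set L : Fin n → ℝ → X × ℝ → ℂ := fun i c p =>
    Complex.exp (Complex.I * ((p.2 * g i c p.1 : ℝ) : ℂ)) - 1 with hL
  have hbd : ∀ i c x, |g i c x| ≤ |c| := fun i c x => by
    by_cases h : x ∈ A i
    · simp [g, h]
    · simp [g, h]
  have hsupp : ∀ i c x, x ∉ closure (A i) → g i c x = 0 := fun i c x hx =>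
    indicator_of_notMem (fun h => hx (subset_closure h)) _
  have hLint : ∀ i c, Integrable (L i c) M := fun i c =>
    hM.integrable_exp_sub_one (hgm i c) (hA i).2 (hsupp i c) (hbd i c)
  rw [iIndepFun_iff_charFun_pi fun i => (hXm i).aemeasurable]
  intro t
  have hone : ∀ i, charFun (μ.map fun η : RadonMeasure X => η.1.real (A i)) (t i) =
      Complex.exp (∫ p, L i (t i) p ∂M) := fun i => by
    rw [← hμ.fourier_of_bounded hM (hgm i (t i)) (hA i).2 (hsupp i (t i)) (hbd i (t i)),
      charFun_apply_real, integral_map (hXm i).aemeasurable (by fun_prop)]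
    refine integral_congr_ae (Eventually.of_forall fun η => ?_)
    simp only [hgi]
    push_cast
    congr 1
    ring
  set G : X → ℝ := fun x => ∑ i, g i (t i) x with hG
  have hGm : Measurable G := Finset.measurable_fun_sum _ fun i _ => hgm i (t i)
  have hGi : ∀ η : RadonMeasure X, ∫ x, G x ∂η.1 = ∑ i, η.1.real (A i) * t i := fun η => by
    simp only [hG]
    rw [integral_finsetSum _ fun i _ => hint i η (t i)]
    exact Finset.sum_congr rfl fun i _ => hgi i (t i) η
  have hGK : ∀ x, x ∉ ⋃ i, closure (A i) → G x = 0 := fun x hx =>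
    Finset.sum_eq_zero fun i _ => hsupp i (t i) x fun h => hx (mem_iUnion_of_mem i h)
  have hGC : ∀ x, |G x| ≤ ∑ i, |t i| := fun x =>
    (Finset.abs_sum_le_sum_abs _ _).trans (Finset.sum_le_sum fun i _ => hbd i (t i) x)
  have hTm : Measurable fun η : RadonMeasure X => WithLp.toLp 2 fun i => η.1.real (A i) :=
    (MeasurableEquiv.toLp 2 (Fin n → ℝ)).measurable.comp (measurable_pi_lambda _ hXm)
  have hjoint : charFun (μ.map fun η : RadonMeasure X => WithLp.toLp 2 fun i => η.1.real (A i)) t =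
      Complex.exp (∫ p, (Complex.exp (Complex.I * ((p.2 * G p.1 : ℝ) : ℂ)) - 1) ∂M) := by
    rw [← hμ.fourier_of_bounded hM hGm (isCompact_iUnion fun i => (hA i).2) hGK hGC,
      charFun_apply, integral_map hTm.aemeasurable (by fun_prop)]
    refine integral_congr_ae (Eventually.of_forall fun η => ?_)
    simp only [hGi]
    rw [mul_comm]
    congr 3
    rw [PiLp.inner_apply]
    refine Finset.sum_congr rfl fun i _ => ?_
    simp [mul_comm]
  -- At most one `A i` contains `p.1`, so the exponent is additive over the sets and its exponential
  -- is a product.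
  have hsplit : ∀ p : X × ℝ, Complex.exp (Complex.I * ((p.2 * G p.1 : ℝ) : ℂ)) - 1 =
      ∑ i, L i (t i) p := fun p => by
    have hz : ∀ i, p.1 ∉ A i → L i (t i) p = 0 := fun i hi => by
      simp [hL, g, indicator_of_notMem hi]
    by_cases hex : ∃ j, p.1 ∈ A j
    · obtain ⟨j, hj⟩ := hex
      have hnot : ∀ i, i ≠ j → p.1 ∉ A i := fun i hij hi =>
        disjoint_left.1 (hd hij) hi hj
      have hGj : G p.1 = g j (t j) p.1 :=
        Finset.sum_eq_single j (fun i _ hij => indicator_of_notMem (hnot i hij) _)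
          fun h => absurd (Finset.mem_univ j) h
      rw [Finset.sum_eq_single j (fun i _ hij => hz i (hnot i hij))
        fun h => absurd (Finset.mem_univ j) h, hGj]
    · push Not at hex
      have hG0 : G p.1 = 0 := Finset.sum_eq_zero fun i _ => indicator_of_notMem (hex i) _
      rw [Finset.sum_eq_zero fun i _ => hz i (hex i), hG0]
      simp
  rw [hjoint, Finset.prod_congr rfl fun i _ => hone i, ← Complex.exp_sum]
  simp only [hsplit]
  rw [integral_finsetSum _ fun i _ => hLint i (t i)]

theorem hasLevyMeasure : HasLevyMeasure M μ where
  completelyRandom :=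
    { isProbabilityMeasure := hμ.isProbabilityMeasure
      indep := fun n A hA hd => by
        have h := (iIndepFun_real hM hμ hA hd).comp (fun _ => ENNReal.ofReal)
          fun _ => ENNReal.measurable_ofReal
        have e : (fun (i : Fin n) (η : RadonMeasure X) => η.1 (A i)) =
            fun i => ENNReal.ofReal ∘ fun η : RadonMeasure X => η.1.real (A i) := by
          funext i η
          exact (ENNReal.ofReal_toReal
            ((measure_mono subset_closure).trans_lt (η.2 _ (hA i).2)).ne).symm
        rw [e]
        exact h }
  discrete := hμ.discrete
  fourier f := by
    obtain ⟨C, hC⟩ := f.hasCompactSupport.exists_bound_of_continuous f.continuous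
    exact fourier_of_bounded hM hμ f.continuous.measurable f.hasCompactSupport
      (fun x hx => image_eq_zero_of_notMem_tsupport hx) hC

end HasPoissonMarks

theorem HasLevyMeasure.unique {M : Measure (X × ℝ)} {μ ν : Measure (RadonMeasure X)}
    (hμ : HasLevyMeasure M μ) (hν : HasLevyMeasure M ν) : μ = ν := by
  have := hμ.completelyRandom.isProbabilityMeasure
  have := hν.completelyRandom.isProbabilityMeasure
  exact RadonMeasure.ext_of_fourier fun f => (hμ.fourier f).trans (hν.fourier f).symm

end

/-! ### Change of the Lévy measure by a density. -/

/-- Passes from integrability of `e^φ - 1` to that of `min(|φ|, 1)`, the condition for absolute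
convergence of the sum of `φ` over the Poisson points. -/
theorem min_abs_one_le_abs_exp_sub_one (y : ℝ) : min |y| 1 ≤ 2 * |Real.exp y - 1| := by
  rcases le_total 0 y with hy | hy
  · have h := Real.add_one_le_exp y
    rw [abs_of_nonneg hy, abs_of_nonneg (by linarith)]
    exact (min_le_left _ _).trans (by linarith)
  · have h1 : Real.exp y ≤ 1 := Real.exp_le_one_iff.2 hy
    rw [abs_of_nonpos hy, abs_of_nonpos (by linarith)]
    by_cases h : Real.exp y ≤ 1 / 2
    · exact (min_le_right _ _).trans (by linarith)
    · have h2 := Real.add_one_le_exp (-y)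
      have h3 : Real.exp (-y) * Real.exp y = 1 := by rw [← Real.exp_add]; simp
      have h4 := Real.exp_pos (-y)
      refine (min_le_left _ _).trans ?_
      nlinarith

/-- The multiplication of the marks by a current. -/
def scaleMarks {X : Type*} [TopologicalSpace X] (θ : currentGroup X) (p : X × ℝ) : X × ℝ :=
  (p.1, currentVal θ p.1 * p.2)

section

variable {X : Type*} [TopologicalSpace X] [LocallyCompactSpace X] [PolishSpace X]
  [MeasurableSpace X] [BorelSpace X]

theorem measurable_scaleMarks (θ : currentGroup X) : Measurable (scaleMarks θ) :=
  measurable_fst.prodMk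
    (((continuous_currentVal θ).measurable.comp measurable_fst).mul measurable_snd)

theorem RadonMeasure.integral_marked_ofReal (φ : X × ℝ → ℝ) (η : RadonMeasure X) :
    ∫ x, RadonMeasure.marked (fun p => (φ p : ℂ)) η x ∂η.1 =
      ((∫ x, (η.weight x)⁻¹ * φ (x, η.weight x) ∂η.1 : ℝ) : ℂ) := by
  rw [← integral_complex_ofReal]
  refine integral_congr_ae (Eventually.of_forall fun x => ?_)
  simp only [RadonMeasure.marked, Complex.real_smul]
  push_cast
  rfl

namespace HasPoissonMarks

variable {M : Measure (X × ℝ)} {μ : Measure (RadonMeasure X)}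

theorem lintegral_min_log_lt_top {φ : X × ℝ → ℝ}
    (hint : Integrable (fun p => Real.exp (φ p) - 1) M) :
    ∫⁻ p, min ‖((φ p : ℝ) : ℂ)‖ₑ 1 ∂M < ∞ := by
  refine lt_of_le_of_lt (lintegral_mono fun p => ?_) (hint.const_mul 2).2
  rw [← ofReal_norm, ← ofReal_norm, ← ENNReal.ofReal_one, ← ENNReal.ofReal_min, Complex.norm_real,
    norm_mul, Real.norm_eq_abs, Real.norm_eq_abs, Real.norm_eq_abs, abs_two]
  exact ENNReal.ofReal_le_ofReal (min_abs_one_le_abs_exp_sub_one _)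

theorem ae_integrable_log (hμ : HasPoissonMarks M μ) {φ : X × ℝ → ℝ} (hφ : Measurable φ)
    (hint : Integrable (fun p => Real.exp (φ p) - 1) M) :
    ∀ᵐ η ∂μ, Integrable (RadonMeasure.marked (fun p => (φ p : ℂ)) η) η.1 :=
  hμ.ae_integrable _ (Complex.measurable_ofReal.comp hφ) (lintegral_min_log_lt_top hint)

/-- Absolute continuity of the laws of random discrete measures with respect to a change of the
Lévy measure by a density and the corresponding multiplication by a current. -/
theorem map_smul_eq_withDensity (hM : IsLevyIntensity M) (hμ : HasPoissonMarks M μ)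
    (θ : currentGroup X) {φ : X × ℝ → ℝ} (hφ : Measurable φ)
    (hint : Integrable (fun p => Real.exp (φ p) - 1) M)
    (hmap : M.map (scaleMarks θ) = M.withDensity fun p => ENNReal.ofReal (Real.exp (φ p))) :
    μ.map (fun η => θ • η) = μ.withDensity fun η => ENNReal.ofReal (Real.exp
      (∫ x, (η.weight x)⁻¹ * φ (x, η.weight x) ∂η.1 - ∫ p, (Real.exp (φ p) - 1) ∂M)) := by
  have := hμ.isProbabilityMeasure
  have hsm := RadonMeasure.measurable_smul θ
  have hφC : Measurable fun p => ((φ p : ℝ) : ℂ) := Complex.measurable_ofReal.comp hφ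
  have hφmin := lintegral_min_log_lt_top hint
  have hexpC : ∀ p, Complex.exp ((φ p : ℝ) : ℂ) - 1 = ((Real.exp (φ p) - 1 : ℝ) : ℂ) := fun p => by
    push_cast; rfl
  have hintC : Integrable (fun p => Complex.exp ((φ p : ℝ) : ℂ) - 1) M := by
    simp only [hexpC]
    exact hint.ofReal
  set c : ℝ := ∫ p, (Real.exp (φ p) - 1) ∂M with hc
  set S : RadonMeasure X → ℝ := fun η => ∫ x, (η.weight x)⁻¹ * φ (x, η.weight x) ∂η.1 with hS
  have hSC : ∀ η : RadonMeasure X,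
      ∫ x, RadonMeasure.marked (fun p => (φ p : ℂ)) η x ∂η.1 = (S η : ℂ) := fun η =>
    RadonMeasure.integral_marked_ofReal φ η
  have hSm : Measurable S := by
    have := (RadonMeasure.measurable_integral_marked hφC).re
    simpa only [hSC, RCLike.re_to_complex, Complex.ofReal_re] using this
  have hDm : Measurable fun η => ENNReal.ofReal (Real.exp (S η - c)) :=
    (hSm.sub_const c).exp.ennreal_ofReal
  have hexpS : Integrable (fun η => Real.exp (S η)) μ := by
    have h := (hμ.integrable_exp _ hφC hφmin hintC).norm
    simp only [hSC, Complex.norm_exp_ofReal] at h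
    exact h
  have hDint : Integrable (fun η => Real.exp (S η - c)) μ := by
    simp only [Real.exp_sub]
    exact hexpS.div_const _
  have hfin1 : IsFiniteMeasure (μ.map fun η => θ • η) := inferInstance
  have hfin2 : IsFiniteMeasure (μ.withDensity fun η => ENNReal.ofReal (Real.exp (S η - c))) :=
    isFiniteMeasure_withDensity_ofReal hDint.2
  refine RadonMeasure.ext_of_fourier fun f => ?_
  obtain ⟨C, hC⟩ := f.hasCompactSupport.exists_bound_of_continuous f.continuous
  obtain ⟨C', hC'⟩ := (RadonMeasure.currentMul θ f).hasCompactSupport.exists_bound_of_continuous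
    (RadonMeasure.currentMul θ f).continuous
  have hf0 : ∀ x, x ∉ tsupport f → f x = 0 := fun x hx => image_eq_zero_of_notMem_tsupport hx
  have hθf0 : ∀ x, x ∉ tsupport (RadonMeasure.currentMul θ f) → RadonMeasure.currentMul θ f x = 0 :=
    fun x hx => image_eq_zero_of_notMem_tsupport hx
  have hfc : Measurable fun x => f x := f.continuous.measurable
  have hθfm : Measurable fun x => RadonMeasure.currentMul θ f x :=
    (RadonMeasure.currentMul θ f).continuous.measurable
  have hfm : Measurable fun p : X × ℝ => Complex.I * ((p.2 * f p.1 : ℝ) : ℂ) :=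
    (Complex.measurable_ofReal.comp
      (measurable_snd.mul (f.continuous.measurable.comp measurable_fst))).const_mul _
  have hGm : Measurable fun p : X × ℝ =>
      Complex.exp (Complex.I * ((p.2 * f p.1 : ℝ) : ℂ)) - 1 := hfm.cexp.sub_const 1
  have hF := RadonMeasure.measurable_integral f
  have hFm : Measurable fun η : RadonMeasure X =>
      Complex.exp (Complex.I * ((∫ x, f x ∂η.1 : ℝ) : ℂ)) :=
    ((Complex.measurable_ofReal.comp hF).const_mul _).cexp
  have hscale : ∀ p : X × ℝ, Complex.exp (Complex.I *
      (((scaleMarks θ p).2 * f (scaleMarks θ p).1 : ℝ) : ℂ)) - 1 =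
      Complex.exp (Complex.I * ((p.2 * RadonMeasure.currentMul θ f p.1 : ℝ) : ℂ)) - 1 := fun p => by
    have : (scaleMarks θ p).2 * f (scaleMarks θ p).1 = p.2 * RadonMeasure.currentMul θ f p.1 := by
      change currentVal θ p.1 * p.2 * f p.1 = p.2 * (currentVal θ p.1 * f p.1)
      ring
    rw [this]
  have hexpm : Measurable fun p => ENNReal.ofReal (Real.exp (φ p)) := hφ.exp.ennreal_ofReal
  have hlt : ∀ᵐ p ∂M, ENNReal.ofReal (Real.exp (φ p)) < ∞ :=
    Eventually.of_forall fun _ => ENNReal.ofReal_lt_top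
  have hsmul : ∀ (p : X × ℝ) (z : ℂ),
      (ENNReal.ofReal (Real.exp (φ p))).toReal • z = Complex.exp (φ p : ℂ) * z := fun p z => by
    rw [ENNReal.toReal_ofReal (Real.exp_pos _).le, Complex.real_smul, Complex.ofReal_exp]
  -- Integrability for `e^φ M` is integrability for the image of `M` under the scaling, hence that
  -- of the same function with `f` replaced by `θ f`, for `M` itself.
  have hGint : Integrable (fun p => Complex.exp (φ p : ℂ) *
      (Complex.exp (Complex.I * ((p.2 * f p.1 : ℝ) : ℂ)) - 1)) M := by
    have h1 := hM.integrable_exp_sub_one hθfm (RadonMeasure.currentMul θ f).hasCompactSupport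
      hθf0 hC'
    rw [← funext hscale] at h1
    have h2 := (integrable_map_measure (μ := M) hGm.aestronglyMeasurable
      (measurable_scaleMarks θ).aemeasurable).2 h1
    rw [hmap, integrable_withDensity_iff_integrable_smul' hexpm hlt] at h2
    simpa only [hsmul] using h2
  -- The Fourier functional of the image law at `f` is that of `μ` at `θ f`; the change of variables
  -- in the exponent produces the factor `e^φ`.
  have hleft : ∫ η : RadonMeasure X, Complex.exp (Complex.I * ((∫ x, f x ∂η.1 : ℝ) : ℂ))
      ∂(μ.map fun η => θ • η) = Complex.exp (∫ p, Complex.exp (φ p : ℂ) *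
        (Complex.exp (Complex.I * ((p.2 * f p.1 : ℝ) : ℂ)) - 1) ∂M) := by
    rw [integral_map hsm.aemeasurable hFm.aestronglyMeasurable]
    simp only [RadonMeasure.integral_smul]
    have h1 := hμ.fourier_of_bounded hM hθfm (RadonMeasure.currentMul θ f).hasCompactSupport
      hθf0 hC'
    refine h1.trans ?_
    congr 1
    rw [← funext hscale]
    have h2 := integral_map (μ := M) (measurable_scaleMarks θ).aemeasurable hGm.aestronglyMeasurable
    rw [← h2, hmap, integral_withDensity_eq_integral_toReal_smul hexpm hlt]
    simp only [hsmul]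
  have hψm : Measurable fun p : X × ℝ => Complex.I * ((p.2 * f p.1 : ℝ) : ℂ) + (φ p : ℂ) :=
    hfm.add hφC
  -- The first summand is the exponent of the image law. The second integrates to `c`, which the
  -- normalization `e^{-c}` of the density removes.
  have hψe : ∀ p : X × ℝ, Complex.exp (Complex.I * ((p.2 * f p.1 : ℝ) : ℂ) + (φ p : ℂ)) - 1 =
      Complex.exp (φ p : ℂ) * (Complex.exp (Complex.I * ((p.2 * f p.1 : ℝ) : ℂ)) - 1) +
        ((Real.exp (φ p) - 1 : ℝ) : ℂ) := fun p => by
    rw [Complex.exp_add, ← hexpC]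
    ring
  have hψmin : ∫⁻ p : X × ℝ,
      min ‖Complex.I * ((p.2 * f p.1 : ℝ) : ℂ) + (φ p : ℂ)‖ₑ 1 ∂M < ∞ := by
    have h1 := hM.lintegral_min_mul_lt_top hfc f.hasCompactSupport hf0 hC
    refine lt_of_le_of_lt (lintegral_mono fun p => ?_)
      ((lintegral_add_right _ (hφC.enorm.min measurable_const)).trans_lt
        (ENNReal.add_lt_top.2 ⟨h1, hφmin⟩))
    have h2 : ‖Complex.I * ((p.2 * f p.1 : ℝ) : ℂ) + (φ p : ℂ)‖ₑ ≤
        ‖p.2 * f p.1‖ₑ + ‖((φ p : ℝ) : ℂ)‖ₑ := by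
      refine (enorm_add_le _ _).trans (add_le_add_left (le_of_eq ?_) _)
      rw [← ofReal_norm, ← ofReal_norm, norm_mul, Complex.norm_I, one_mul, Complex.norm_real]
    refine (min_le_min_right 1 h2).trans ?_
    rcases le_total ‖p.2 * f p.1‖ₑ 1 with ha | ha
    · rcases le_total ‖((φ p : ℝ) : ℂ)‖ₑ 1 with hb | hb
      · rw [min_eq_left ha, min_eq_left hb]
        exact min_le_left _ _
      · rw [min_eq_right hb]
        exact (min_le_right _ _).trans le_add_self
    · rw [min_eq_right ha]
      exact (min_le_right _ _).trans le_self_add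
  have hψint : Integrable (fun p : X × ℝ =>
      Complex.exp (Complex.I * ((p.2 * f p.1 : ℝ) : ℂ) + (φ p : ℂ)) - 1) M := by
    simp only [hψe]
    exact hGint.add hint.ofReal
  rw [hleft, integral_withDensity_eq_integral_toReal_smul hDm
    (Eventually.of_forall fun _ => ENNReal.ofReal_lt_top)]
  have hψ := hμ.integral_exp _ hψm hψmin hψint
  have hsplit : ∫ p : X × ℝ,
      (Complex.exp (Complex.I * ((p.2 * f p.1 : ℝ) : ℂ) + (φ p : ℂ)) - 1) ∂M =
      ∫ p : X × ℝ, Complex.exp (φ p : ℂ) *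
        (Complex.exp (Complex.I * ((p.2 * f p.1 : ℝ) : ℂ)) - 1) ∂M + (c : ℂ) := by
    rw [funext hψe]
    refine (integral_add hGint hint.ofReal).trans ?_
    exact congrArg _ integral_complex_ofReal
  have hψ := hψ.trans (congrArg Complex.exp hsplit)
  rw [Complex.exp_add] at hψ
  have hright : ∀ᵐ η ∂μ, (ENNReal.ofReal (Real.exp (S η - c))).toReal •
      Complex.exp (Complex.I * ((∫ x, f x ∂η.1 : ℝ) : ℂ)) = Complex.exp (-(c : ℂ)) *
      Complex.exp (∫ x, RadonMeasure.marked (fun p : X × ℝ =>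
        Complex.I * ((p.2 * f p.1 : ℝ) : ℂ) + (φ p : ℂ)) η x ∂η.1) := by
    filter_upwards [hμ.discrete, hμ.ae_integrable_log hφ hint] with η h1 h2
    have e : ∫ x, RadonMeasure.marked (fun p : X × ℝ =>
        Complex.I * ((p.2 * f p.1 : ℝ) : ℂ) + (φ p : ℂ)) η x ∂η.1 =
        Complex.I * ((∫ x, f x ∂η.1 : ℝ) : ℂ) + (S η : ℂ) := by
      refine (integral_congr_ae (RadonMeasure.marked_mul_ae h1 f fun p => (φ p : ℂ))).trans ?_
      refine (integral_add ((η.integrable f).ofReal.const_mul _) h2).trans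
        (congrArg₂ _ ?_ (hSC η))
      exact (integral_const_mul _ _).trans (congrArg _ integral_complex_ofReal)
    refine Eq.trans ?_ (congrArg (fun z => Complex.exp (-(c : ℂ)) * Complex.exp z) e).symm
    rw [ENNReal.toReal_ofReal (Real.exp_pos _).le, Complex.real_smul, Complex.ofReal_exp,
      ← Complex.exp_add, ← Complex.exp_add]
    congr 1
    push_cast
    ring
  rw [integral_congr_ae hright, integral_const_mul, hψ, mul_left_comm, ← Complex.exp_add]
  simp [hc]

end HasPoissonMarks

end

/-! ### The reference measure σ ⊗ ds/s and regular Lévy densities. -/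

noncomputable section

/-- The scale-invariant measure `ds / s` on `(0, ∞)`. -/
def scaleInvariant : Measure ℝ :=
  (volume.restrict (Ioi 0)).withDensity fun s => ENNReal.ofReal s⁻¹

instance : SFinite scaleInvariant := by unfold scaleInvariant; infer_instance

theorem map_mul_scaleInvariant {c : ℝ} (hc : 0 < c) :
    scaleInvariant.map (fun s => c * s) = scaleInvariant := by
  refine Measure.ext_of_lintegral _ fun g hg => ?_
  have hm : Measurable fun s : ℝ => ENNReal.ofReal s⁻¹ := measurable_inv.ennreal_ofReal
  have hc' : Measurable fun s : ℝ => c * s := measurable_const_mul c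
  have key : ∀ k : ℝ → ℝ≥0∞, Measurable k →
      ∫⁻ s, k s ∂scaleInvariant = ∫⁻ s, (Ioi 0).indicator (fun s => ENNReal.ofReal s⁻¹ * k s) s := by
    intro k hk
    rw [scaleInvariant, lintegral_withDensity_eq_lintegral_mul _ hm hk,
      lintegral_indicator measurableSet_Ioi]
    rfl
  have hF : Measurable ((Ioi (0 : ℝ)).indicator fun s => ENNReal.ofReal s⁻¹ * g s) :=
    (hm.mul hg).indicator measurableSet_Ioi
  have h := Real.smul_map_volume_mul_left hc.ne'
  rw [lintegral_map hg hc', key (fun s => g (c * s)) (hg.comp hc'), key _ hg]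
  conv_rhs => rw [← h]
  rw [lintegral_smul_measure, lintegral_map hF hc', smul_eq_mul]
  refine Eq.trans (lintegral_congr fun s => ?_) (lintegral_const_mul _ (hF.comp hc'))
  by_cases hs : 0 < s
  · rw [indicator_of_mem (show s ∈ Ioi (0 : ℝ) from hs),
      indicator_of_mem (show c * s ∈ Ioi (0 : ℝ) from mul_pos hc hs), abs_of_pos hc, ← mul_assoc,
      ← ENNReal.ofReal_mul hc.le]
    congr 2
    field_simp
  · rw [indicator_of_notMem (show s ∉ Ioi (0 : ℝ) from hs), indicator_of_notMem
      (show c * s ∉ Ioi (0 : ℝ) from fun h => hs ((mul_pos_iff_of_pos_left hc).1 h)), mul_zero]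

section

variable {X : Type*} [TopologicalSpace X] [LocallyCompactSpace X] [PolishSpace X]
  [MeasurableSpace X] [BorelSpace X] {σ : Measure X} {l : X → ℝ → ℝ}

theorem prod_scaleInvariant (σ : Measure X) [SFinite σ] : σ.prod scaleInvariant =
    (σ.prod (volume.restrict (Ioi (0 : ℝ)))).withDensity fun p => ENNReal.ofReal p.2⁻¹ := by
  rw [scaleInvariant, prod_withDensity_right₀ measurable_inv.ennreal_ofReal.aemeasurable]

theorem measurePreserving_scaleMarks (σ : Measure X) [SFinite σ] (θ : currentGroup X) :
    MeasurePreserving (scaleMarks θ) (σ.prod scaleInvariant) (σ.prod scaleInvariant) :=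
  (MeasurePreserving.id σ).skew_product (g := fun x s => currentVal θ x * s)
    ((continuous_currentVal θ).measurable.comp measurable_fst |>.mul measurable_snd)
    (Eventually.of_forall fun x => map_mul_scaleInvariant (RadonMeasure.currentVal_pos θ x))

theorem scaleMarks_inv_apply (θ : currentGroup X) (p : X × ℝ) :
    scaleMarks θ⁻¹ p = (p.1, (currentVal θ p.1)⁻¹ * p.2) := rfl

theorem scaleMarks_inv_scaleMarks (θ : currentGroup X) (p : X × ℝ) :
    scaleMarks θ⁻¹ (scaleMarks θ p) = p := by
  have h := (RadonMeasure.currentVal_pos θ p.1).ne'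
  refine Prod.ext rfl ?_
  change (currentVal θ p.1)⁻¹ * (currentVal θ p.1 * p.2) = p.2
  field_simp

/-- The function `l`, set to zero off `X × (0, ∞)`. -/
def zeroExtend (l : X → ℝ → ℝ) (p : X × ℝ) : ℝ := (Ioi (0 : ℝ)).indicator (l p.1) p.2

theorem zeroExtend_of_pos (l : X → ℝ → ℝ) {x : X} {s : ℝ} (hs : 0 < s) :
    zeroExtend l (x, s) = l x s := indicator_of_mem (show s ∈ Ioi (0 : ℝ) from hs) _

theorem zeroExtend_of_nonpos (l : X → ℝ → ℝ) {p : X × ℝ} (hs : ¬0 < p.2) :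
    zeroExtend l p = 0 := indicator_of_notMem (show p.2 ∉ Ioi (0 : ℝ) from hs) _

/-- The values of `l` at nonpositive arguments are arbitrary; cutting them off yields a function
measurable on all of `X × ℝ`. -/
theorem measurable_zeroExtend (h : Measurable fun p : X × Ioi (0 : ℝ) => l p.1 p.2) :
    Measurable (zeroExtend l) := by
  have hs : MeasurableSet {p : X × ℝ | 0 < p.2} := measurableSet_lt measurable_const measurable_snd
  refine measurable_of_restrict_of_restrict_compl hs ?_ ?_
  · have h1 : Measurable fun p : {p : X × ℝ | 0 < p.2} => ((p.1.1, ⟨p.1.2, p.2⟩) : X × Ioi (0 : ℝ)) :=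
      (measurable_fst.comp measurable_subtype_coe).prodMk
        ((measurable_snd.comp measurable_subtype_coe).subtype_mk)
    convert h.comp h1 using 1
    funext p
    exact zeroExtend_of_pos l p.2
  · convert (measurable_const : Measurable fun _ : ({p : X × ℝ | 0 < p.2}ᶜ : Set _) => (0 : ℝ)) using 1
    funext p
    exact zeroExtend_of_nonpos l p.2

theorem zeroExtend_nonneg (hl : ∀ x, (∀ s, 0 < s → 0 < l x s) ∨ (∀ s, 0 < s → l x s = 0))
    (p : X × ℝ) : 0 ≤ zeroExtend l p := by
  refine indicator_nonneg (fun s hs => ?_) _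
  rcases hl p.1 with h | h
  · exact (h s hs).le
  · exact (h s hs).ge

theorem zeroExtend_of_notMem (hl : ∀ x, (∀ s, 0 < s → 0 < l x s) ∨ (∀ s, 0 < s → l x s = 0))
    {p : X × ℝ} (hp : p.1 ∉ positivitySet l) : zeroExtend l p = 0 := by
  rcases hl p.1 with h | h
  · exact absurd h hp
  · by_cases hs : 0 < p.2
    · exact (zeroExtend_of_pos l hs).trans (h _ hs)
    · exact zeroExtend_of_nonpos l hs

theorem measurableSet_positivitySet (hm : Measurable fun p : X × Ioi (0 : ℝ) => l p.1 p.2)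
    (hl : ∀ x, (∀ s, 0 < s → 0 < l x s) ∨ (∀ s, 0 < s → l x s = 0)) :
    MeasurableSet (positivitySet l) := by
  -- By the dichotomy, positivity at the single value `s = 1` decides membership.
  have h : positivitySet l = {x | 0 < zeroExtend l (x, 1)} := by
    ext x
    refine ⟨fun h => (h 1 one_pos).trans_eq (zeroExtend_of_pos l one_pos).symm, fun h => ?_⟩
    by_contra hx
    exact (ne_of_gt h) (zeroExtend_of_notMem (p := (x, 1)) hl hx)
  rw [h]
  exact measurableSet_lt measurable_const
    ((measurable_zeroExtend hm).comp (measurable_id.prodMk measurable_const))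

/-- Moving `1 / s` into the reference measure makes the latter invariant under `scaleMarks`, so a
current acts on the density alone. -/
theorem levyMeasure_eq_withDensity [SFinite σ]
    (hm : Measurable fun p : X × Ioi (0 : ℝ) => l p.1 p.2) :
    levyMeasure σ l =
      (σ.prod scaleInvariant).withDensity fun p => ENNReal.ofReal (zeroExtend l p) := by
  have h1 : Measurable fun p : X × ℝ => ENNReal.ofReal p.2⁻¹ :=
    measurable_snd.inv.ennreal_ofReal
  have h2 := (measurable_zeroExtend hm).ennreal_ofReal
  rw [prod_scaleInvariant, ← withDensity_mul _ h1 h2, levyMeasure]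
  refine withDensity_congr_ae ?_
  have h3 : ∀ᵐ p ∂σ.prod (volume.restrict (Ioi (0 : ℝ))), 0 < p.2 :=
    Measure.quasiMeasurePreserving_snd.ae (ae_restrict_mem measurableSet_Ioi)
  filter_upwards [h3] with p hp
  rw [Pi.mul_apply, ← ENNReal.ofReal_mul (inv_nonneg.2 hp.le), zeroExtend_of_pos l hp,
    div_eq_inv_mul]

theorem setLIntegral_prod_scaleInvariant [SFinite σ] {A : Set X} (hA : MeasurableSet A)
    {g : X × ℝ → ℝ≥0∞} (hg : Measurable g) :
    ∫⁻ p in A ×ˢ (univ : Set ℝ), g p ∂σ.prod scaleInvariant =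
      ∫⁻ p in A ×ˢ Ioi (0 : ℝ), ENNReal.ofReal p.2⁻¹ * g p ∂σ.prod volume := by
  have h1 : Measurable fun p : X × ℝ => ENNReal.ofReal p.2⁻¹ :=
    measurable_snd.inv.ennreal_ofReal
  have h2 : (σ.prod (volume.restrict (Ioi (0 : ℝ)))).restrict (A ×ˢ univ) =
      (σ.prod volume).restrict (A ×ˢ Ioi (0 : ℝ)) := by
    rw [← Measure.prod_restrict, ← Measure.prod_restrict, Measure.restrict_univ]
  have hAu : MeasurableSet (A ×ˢ (univ : Set ℝ)) := hA.prod MeasurableSet.univ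
  rw [prod_scaleInvariant, setLIntegral_withDensity_eq_setLIntegral_mul _ h1 hg hAu, h2]
  rfl

/-- The measurability, sign, integrability and regularity conditions on the density of a Lévy
measure with respect to `σ ⊗ ds / s`. -/
structure IsRegularLevyDensity (σ : Measure X) (l : X → ℝ → ℝ) : Prop where
  measurable : Measurable fun p : X × Ioi (0 : ℝ) => l p.1 p.2
  pos_or_zero : ∀ x, (∀ s, 0 < s → 0 < l x s) ∨ (∀ s, 0 < s → l x s = 0)
  integrable : ∀ A ⊆ positivitySet l, IsBoundedBorel A →
    ∫⁻ p in A ×ˢ Ioi (0 : ℝ), ENNReal.ofReal (l p.1 p.2 * min p.2⁻¹ 1) ∂(σ.prod volume) < ∞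
  regular : ∀ n : ℕ, 1 ≤ n → ∃ ε : ℝ, 0 < ε ∧
    ∀ A ⊆ positivitySet l, IsBoundedBorel A →
      ∫⁻ x in A, (⨆ r ∈ Icc (1 / (n : ℝ)) (n : ℝ),
        ∫⁻ s in Ioo 0 ε, ENNReal.ofReal (|l x (r * s) - l x s| / s)) ∂σ < ∞

namespace IsRegularLevyDensity

/-- Off the positivity set the density vanishes, so a compact `K` may be cut down to a set on which
integrability is assumed; there `s⁻¹ min(s, 1) = min(s⁻¹, 1)`. Fibres are null because `σ` has no
atoms. -/
theorem isLevyIntensity [SFinite σ] [NullSingletonClass σ] (h : IsRegularLevyDensity σ l) :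
    IsLevyIntensity (levyMeasure σ l) := by
  have hL := (measurable_zeroExtend h.measurable).ennreal_ofReal
  have hY := measurableSet_positivitySet h.measurable h.pos_or_zero
  have hac : levyMeasure σ l ≪ σ.prod scaleInvariant := by
    rw [levyMeasure_eq_withDensity h.measurable]
    exact withDensity_absolutelyContinuous _ _
  refine ⟨?_, fun K hK => ?_, fun x => hac ?_⟩
  · refine (withDensity_absolutelyContinuous _ _).ae_le ?_
    exact Measure.quasiMeasurePreserving_snd.ae (ae_restrict_mem measurableSet_Ioi)
  · have hKY : IsBoundedBorel (K ∩ positivitySet l) :=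
      ⟨hK.measurableSet.inter hY, hK.closure_of_subset inter_subset_left⟩
    have hg : Measurable fun p : X × ℝ => ENNReal.ofReal (min p.2 1) :=
      (measurable_snd.min measurable_const).ennreal_ofReal
    have hKu : MeasurableSet (K ×ˢ (univ : Set ℝ)) := hK.measurableSet.prod MeasurableSet.univ
    have hKYu : MeasurableSet ((K ∩ positivitySet l) ×ˢ (univ : Set ℝ)) :=
      hKY.1.prod MeasurableSet.univ
    have hbd := h.integrable _ inter_subset_right hKY
    rw [levyMeasure_eq_withDensity h.measurable,
      setLIntegral_withDensity_eq_setLIntegral_mul _ hL hg hKu]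
    refine lt_of_le_of_lt ?_ hbd
    have h1 : ∫⁻ p in K ×ˢ (univ : Set ℝ), ((fun p => ENNReal.ofReal (zeroExtend l p)) *
        fun p : X × ℝ => ENNReal.ofReal (min p.2 1)) p ∂σ.prod scaleInvariant ≤
        ∫⁻ p in (K ∩ positivitySet l) ×ˢ (univ : Set ℝ),
          ENNReal.ofReal (zeroExtend l p) * ENNReal.ofReal (min p.2 1)
            ∂σ.prod scaleInvariant := by
      rw [← lintegral_indicator hKu, ← lintegral_indicator hKYu]
      refine lintegral_mono fun p => ?_
      by_cases hp : p.1 ∈ positivitySet l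
      · by_cases hpK : p.1 ∈ K
        · rw [indicator_of_mem (show p ∈ K ×ˢ (univ : Set ℝ) from ⟨hpK, mem_univ _⟩),
            indicator_of_mem (show p ∈ (K ∩ positivitySet l) ×ˢ (univ : Set ℝ) from
              ⟨⟨hpK, hp⟩, mem_univ _⟩)]
          rfl
        · rw [indicator_of_notMem (show p ∉ K ×ˢ (univ : Set ℝ) from fun h => hpK h.1)]
          exact bot_le
      · refine (indicator_le_self _ _ p).trans ?_
        rw [Pi.mul_apply, zeroExtend_of_notMem h.pos_or_zero hp, ENNReal.ofReal_zero, zero_mul]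
        exact bot_le
    refine h1.trans ?_
    refine (setLIntegral_prod_scaleInvariant hKY.1 (hL.mul hg)).trans_le ?_
    refine setLIntegral_mono' (hKY.1.prod measurableSet_Ioi) fun p hp => le_of_eq ?_
    have hs : 0 < p.2 := hp.2
    rw [Pi.mul_apply, zeroExtend_of_pos l hs, ← ENNReal.ofReal_mul (hp.1.2 _ hs).le,
      ← ENNReal.ofReal_mul (inv_nonneg.2 hs.le), mul_left_comm,
      mul_min_of_nonneg _ _ (inv_nonneg.2 hs.le), inv_mul_cancel₀ hs.ne', mul_one, min_comm]
  · have e : (Prod.fst ⁻¹' {x} : Set (X × ℝ)) = {x} ×ˢ univ := by ext; simp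
    rw [e, Measure.prod_prod, measure_singleton, zero_mul]

/-- The density of the Lévy measure minus its image under the inverse rescaling of the marks. -/
def _root_.scaleDiff (l : X → ℝ → ℝ) (θ : currentGroup X) (p : X × ℝ) : ℝ :=
  zeroExtend l p - zeroExtend l (scaleMarks θ⁻¹ p)

theorem measurable_scaleDiff (h : IsRegularLevyDensity σ l) (θ : currentGroup X) :
    Measurable (scaleDiff l θ) :=
  (measurable_zeroExtend h.measurable).sub
    ((measurable_zeroExtend h.measurable).comp (measurable_scaleMarks θ⁻¹))

theorem _root_.scaleDiff_of_pos (l : X → ℝ → ℝ) (θ : currentGroup X) {p : X × ℝ} (hp : 0 < p.2) :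
    scaleDiff l θ p = l p.1 p.2 - l p.1 ((currentVal θ p.1)⁻¹ * p.2) :=
  congrArg₂ _ (zeroExtend_of_pos l hp) (zeroExtend_of_pos l
    (mul_pos (inv_pos.2 (RadonMeasure.currentVal_pos θ p.1)) hp))

theorem _root_.scaleDiff_of_nonpos (l : X → ℝ → ℝ) (θ : currentGroup X) {p : X × ℝ}
    (hp : ¬0 < p.2) : scaleDiff l θ p = 0 := by
  rw [scaleDiff, zeroExtend_of_nonpos l hp, zeroExtend_of_nonpos l, sub_zero]
  exact fun h => hp ((mul_pos_iff_of_pos_left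
    (inv_pos.2 (RadonMeasure.currentVal_pos θ p.1))).1 h)

theorem scaleDiff_of_notMem (h : IsRegularLevyDensity σ l) (θ : currentGroup X) {p : X × ℝ}
    (hp : p.1 ∉ positivitySet l) : scaleDiff l θ p = 0 := by
  rw [scaleDiff, zeroExtend_of_notMem h.pos_or_zero hp,
    zeroExtend_of_notMem (p := scaleMarks θ⁻¹ p) h.pos_or_zero hp, sub_zero]

/-- The Lévy measure of marks which are bounded away from zero is finite over compact sets. -/
theorem _root_.IsLevyIntensity.measure_prod_Ici_lt_top {M : Measure (X × ℝ)}
    (hM : IsLevyIntensity M) {K : Set X} (hK : IsCompact K) {δ : ℝ} (hδ : 0 < δ) :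
    M (K ×ˢ Ici δ) < ∞ := by
  have hm : Measurable fun p : X × ℝ => ENNReal.ofReal (min p.2 1) :=
    (measurable_snd.min measurable_const).ennreal_ofReal
  have h0 : ENNReal.ofReal (min δ 1) ≠ 0 := (ENNReal.ofReal_pos.2 (lt_min hδ one_pos)).ne'
  have h1 := mul_meas_ge_le_lintegral (μ := M.restrict (K ×ˢ univ)) hm (ENNReal.ofReal (min δ 1))
  have h2 : M (K ×ˢ Ici δ) ≤ M.restrict (K ×ˢ univ)
      {p | ENNReal.ofReal (min δ 1) ≤ ENNReal.ofReal (min p.2 1)} := by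
    rw [Measure.restrict_apply (measurableSet_le measurable_const hm)]
    exact measure_mono fun p hp =>
      ⟨ENNReal.ofReal_le_ofReal (min_le_min_right _ hp.2), hp.1, mem_univ _⟩
  by_contra hcon
  rw [not_lt, top_le_iff] at hcon
  rw [hcon, top_le_iff] at h2
  rw [h2, ENNReal.mul_top h0, top_le_iff] at h1
  exact (hM.fin K hK).ne h1

end IsRegularLevyDensity

end

end

/-! ### Integrability of the difference between a density and its rescaling. -/

section

variable {X : Type*} [TopologicalSpace X]

/-- A current takes values in some interval `[1/n, n]`. -/
theorem exists_nat_inv_currentVal_mem_Icc (θ : currentGroup X) :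
    ∃ n : ℕ, 1 ≤ n ∧ ∀ x, (currentVal θ x)⁻¹ ∈ Icc (1 / (n : ℝ)) (n : ℝ) := by
  obtain ⟨K, hK, h1⟩ := θ.2.2
  have hpos : ∀ x, 0 < currentVal θ x := fun x => (θ.1 x).2
  obtain ⟨a, ha⟩ := (hK.image (continuous_currentVal θ)).bddAbove
  obtain ⟨b, hb⟩ := (hK.image ((continuous_currentVal θ).inv₀ fun x => (hpos x).ne')).bddAbove
  obtain ⟨n, hn⟩ := exists_nat_ge (max (max a b) 1)
  have hn1 : (1 : ℝ) ≤ n := (le_max_right _ _).trans hn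
  refine ⟨n, by exact_mod_cast hn1, fun x => ?_⟩
  by_cases hx : x ∈ K
  · refine ⟨?_, (hb (mem_image_of_mem _ hx)).trans ((le_max_right _ _).trans
      ((le_max_left _ _).trans hn))⟩
    rw [one_div]
    exact inv_anti₀ (hpos x) ((ha (mem_image_of_mem _ hx)).trans ((le_max_left _ _).trans
      ((le_max_left _ _).trans hn)))
  · have : currentVal θ x = 1 := congrArg Subtype.val (h1 x hx)
    rw [this, inv_one]
    exact ⟨(div_le_one (by linarith)).2 hn1, hn1⟩

end

section

variable {X : Type*} [TopologicalSpace X] [LocallyCompactSpace X] [PolishSpace X]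
  [MeasurableSpace X] [BorelSpace X] {σ : Measure X} {l : X → ℝ → ℝ}

namespace IsRegularLevyDensity

/-- Near zero, the regularity condition controls the difference of the densities. -/
theorem setLIntegral_scaleDiff_lt_top [SFinite σ] (h : IsRegularLevyDensity σ l)
    (θ : currentGroup X) : ∃ ε : ℝ, 0 < ε ∧ ∀ A ⊆ positivitySet l, IsBoundedBorel A →
      ∫⁻ p in A ×ˢ Ioo 0 ε, ENNReal.ofReal |scaleDiff l θ p| ∂σ.prod scaleInvariant < ∞ := by
  obtain ⟨n, hn, hθ⟩ := exists_nat_inv_currentVal_mem_Icc θ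
  obtain ⟨ε, hε, hreg⟩ := h.regular n hn
  refine ⟨ε, hε, fun A hAY hA => lt_of_le_of_lt ?_ (hreg A hAY hA)⟩
  have hm : Measurable fun p => ENNReal.ofReal |scaleDiff l θ p| :=
    (h.measurable_scaleDiff θ).abs.ennreal_ofReal
  rw [← Measure.prod_restrict, lintegral_prod _ hm.aemeasurable]
  refine setLIntegral_mono' hA.1 fun x _ => ?_
  -- For fixed `x` the value `r = θ(x)⁻¹` is admissible in the supremum. The comparison is pointwise
  -- in `x`, so no measurability of the supremum is needed.
  refine le_trans (le_of_eq ?_) (le_iSup₂ (f := fun r (_ : r ∈ Icc (1 / (n : ℝ)) (n : ℝ)) =>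
    ∫⁻ s in Ioo 0 ε, ENNReal.ofReal (|l x (r * s) - l x s| / s)) _ (hθ x))
  have hr : (scaleInvariant).restrict (Ioo 0 ε) =
      (volume.restrict (Ioo 0 ε)).withDensity fun s => ENNReal.ofReal s⁻¹ := by
    rw [scaleInvariant, restrict_withDensity measurableSet_Ioo,
      Measure.restrict_restrict measurableSet_Ioo, inter_eq_left.2 Ioo_subset_Ioi_self]
  rw [hr]
  refine (lintegral_withDensity_eq_lintegral_mul _ measurable_inv.ennreal_ofReal
    (hm.comp measurable_prodMk_left)).trans ?_
  refine setLIntegral_congr_fun measurableSet_Ioo fun s hs => ?_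
  simp only [Pi.mul_apply, Function.comp_apply]
  rw [scaleDiff_of_pos l θ (p := (x, s)) hs.1, ← ENNReal.ofReal_mul (inv_nonneg.2 hs.1.le),
    abs_sub_comm, div_eq_inv_mul]

/-- The difference vanishes where `θ = 1` and off the positivity set, leaving a bounded set `A`. For
`s < ε` the regularity bound applies; for `s ≥ ε` the two terms are estimated separately by the mass
of large marks. -/
theorem integrable_scaleDiff [SFinite σ] [NullSingletonClass σ] (h : IsRegularLevyDensity σ l)
    (θ : currentGroup X) : Integrable (scaleDiff l θ) (σ.prod scaleInvariant) := by
  have hY := measurableSet_positivitySet h.measurable h.pos_or_zero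
  have hL := (measurable_zeroExtend h.measurable).ennreal_ofReal
  obtain ⟨K, hK, h1⟩ := θ.2.2
  obtain ⟨n, hn, hθ⟩ := exists_nat_inv_currentVal_mem_Icc θ
  have hn0 : (0 : ℝ) < n := by exact_mod_cast hn
  obtain ⟨ε, hε, hreg⟩ := h.setLIntegral_scaleDiff_lt_top θ
  set A : Set X := K ∩ positivitySet l with hAdef
  have hA : IsBoundedBorel A :=
    ⟨hK.measurableSet.inter hY, hK.closure_of_subset inter_subset_left⟩
  have htail : ∀ δ : ℝ, 0 < δ → ∫⁻ p, (A ×ˢ Ici δ).indicator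
      (fun p => ENNReal.ofReal (zeroExtend l p)) p ∂σ.prod scaleInvariant < ∞ := fun δ hδ => by
    have h2 := h.isLevyIntensity.measure_prod_Ici_lt_top hK hδ
    have h3 := (measure_mono (prod_mono_left inter_subset_left : A ×ˢ Ici δ ⊆ K ×ˢ Ici δ)).trans_lt h2
    rw [levyMeasure_eq_withDensity h.measurable,
      withDensity_apply _ (hA.1.prod measurableSet_Ici)] at h3
    rwa [lintegral_indicator (hA.1.prod measurableSet_Ici)]
  -- Since `θ⁻¹ ≥ 1 / n`, a mark `s ≥ ε` is rescaled to one of size at least `ε / n`; invariance of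
  -- the reference measure reduces this to the previous tail bound.
  have htail' : ∫⁻ p, (A ×ˢ Ici (1 / n * ε)).indicator
      (fun p => ENNReal.ofReal (zeroExtend l p)) (scaleMarks θ⁻¹ p) ∂σ.prod scaleInvariant < ∞ := by
    rw [(measurePreserving_scaleMarks σ θ⁻¹).lintegral_comp
      (hL.indicator (hA.1.prod measurableSet_Ici))]
    exact htail _ (by positivity)
  have hnear := hreg A inter_subset_right hA
  rw [← lintegral_indicator (hA.1.prod measurableSet_Ioo)] at hnear
  refine ⟨(h.measurable_scaleDiff θ).aestronglyMeasurable, ?_⟩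
  have hm : Measurable fun p => ENNReal.ofReal |scaleDiff l θ p| :=
    (h.measurable_scaleDiff θ).abs.ennreal_ofReal
  refine lt_of_le_of_lt (lintegral_mono (g := fun p =>
    (A ×ˢ Ioo 0 ε).indicator (fun p => ENNReal.ofReal |scaleDiff l θ p|) p +
    ((A ×ˢ Ici ε).indicator (fun p => ENNReal.ofReal (zeroExtend l p)) p +
    (A ×ˢ Ici (1 / n * ε)).indicator (fun p => ENNReal.ofReal (zeroExtend l p))
      (scaleMarks θ⁻¹ p))) fun p => ?_) ?_
  · dsimp only
    rw [← ofReal_norm, Real.norm_eq_abs]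
    by_cases hs : 0 < p.2
    swap
    · rw [scaleDiff_of_nonpos l θ hs, abs_zero, ENNReal.ofReal_zero]
      exact bot_le
    by_cases hp : p.1 ∈ A
    swap
    · have h0 : scaleDiff l θ p = 0 := by
        by_cases hpY : p.1 ∈ positivitySet l
        · have hpK : p.1 ∉ K := fun hpK => hp ⟨hpK, hpY⟩
          have : currentVal θ p.1 = 1 := congrArg Subtype.val (h1 p.1 hpK)
          rw [scaleDiff_of_pos l θ hs, this, inv_one, one_mul, sub_self]
        · exact h.scaleDiff_of_notMem θ hpY
      rw [h0, abs_zero, ENNReal.ofReal_zero]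
      exact bot_le
    rcases lt_or_ge p.2 ε with hpε | hpε
    · rw [indicator_of_mem (show p ∈ A ×ˢ Ioo 0 ε from ⟨hp, hs, hpε⟩)]
      exact le_self_add
    · have h4 : scaleMarks θ⁻¹ p ∈ A ×ˢ Ici (1 / n * ε) :=
        ⟨hp, mul_le_mul (hθ p.1).1 hpε hε.le (inv_pos.2 (RadonMeasure.currentVal_pos θ p.1)).le⟩
      rw [indicator_of_mem (show p ∈ A ×ˢ Ici ε from ⟨hp, hpε⟩), indicator_of_mem h4]
      refine le_trans ?_ le_add_self
      rw [← ENNReal.ofReal_add (zeroExtend_nonneg h.pos_or_zero _)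
        (zeroExtend_nonneg h.pos_or_zero _)]
      refine ENNReal.ofReal_le_ofReal ((abs_sub _ _).trans (le_of_eq ?_))
      rw [abs_of_nonneg (zeroExtend_nonneg h.pos_or_zero _),
        abs_of_nonneg (zeroExtend_nonneg h.pos_or_zero _)]
  · rw [lintegral_add_left (hm.indicator (hA.1.prod measurableSet_Ioo)),
      lintegral_add_left (hL.indicator (hA.1.prod measurableSet_Ici))]
    exact ENNReal.add_lt_top.2 ⟨hnear, ENNReal.add_lt_top.2 ⟨htail ε hε, htail'⟩⟩

end IsRegularLevyDensity

end

/-! ### The logarithmic density and its integrals. -/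

section

variable {X : Type*} [TopologicalSpace X] [LocallyCompactSpace X] [PolishSpace X]
  [MeasurableSpace X] [BorelSpace X] {σ : Measure X} {l : X → ℝ → ℝ}

/-- The logarithm of the density of the rescaled Lévy measure with respect to the Lévy measure. -/
noncomputable def logDensity (l : X → ℝ → ℝ) (θ : currentGroup X) (p : X × ℝ) : ℝ :=
  Real.log (zeroExtend l (scaleMarks θ⁻¹ p) / zeroExtend l p)

namespace IsRegularLevyDensity

theorem measurable_logDensity (h : IsRegularLevyDensity σ l) (θ : currentGroup X) :
    Measurable (logDensity l θ) :=
  (((measurable_zeroExtend h.measurable).comp (measurable_scaleMarks θ⁻¹)).div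
    (measurable_zeroExtend h.measurable)).log

theorem zeroExtend_mul_exp_logDensity (h : IsRegularLevyDensity σ l) (θ : currentGroup X)
    (p : X × ℝ) : zeroExtend l p * Real.exp (logDensity l θ p) =
      zeroExtend l (scaleMarks θ⁻¹ p) := by
  by_cases hY : p.1 ∈ positivitySet l
  swap
  -- Here the logarithm is only a default value, but its factor and the right side both vanish.
  · rw [zeroExtend_of_notMem h.pos_or_zero hY, zero_mul,
      zeroExtend_of_notMem (p := scaleMarks θ⁻¹ p) h.pos_or_zero hY]
  by_cases hs : 0 < p.2
  · have hs' : 0 < (currentVal θ p.1)⁻¹ * p.2 :=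
      mul_pos (inv_pos.2 (RadonMeasure.currentVal_pos θ p.1)) hs
    have h1 : 0 < zeroExtend l p := (hY _ hs).trans_eq (zeroExtend_of_pos l hs).symm
    have h2 : 0 < zeroExtend l (scaleMarks θ⁻¹ p) :=
      (hY _ hs').trans_eq (zeroExtend_of_pos l hs').symm
    rw [logDensity, Real.exp_log (div_pos h2 h1), mul_div_cancel₀ _ h1.ne']
  · rw [zeroExtend_of_nonpos l hs, zero_mul, zeroExtend_of_nonpos l]
    exact fun h => hs ((mul_pos_iff_of_pos_left
      (inv_pos.2 (RadonMeasure.currentVal_pos θ p.1))).1 h)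

/-- Since σ ⊗ ds/s is preserved, pushing forward only composes the density with the inverse scaling.
-/
theorem map_scaleMarks_levyMeasure [SFinite σ] (h : IsRegularLevyDensity σ l)
    (θ : currentGroup X) : (levyMeasure σ l).map (scaleMarks θ) =
      (levyMeasure σ l).withDensity fun p => ENNReal.ofReal (Real.exp (logDensity l θ p)) := by
  have hL := (measurable_zeroExtend h.measurable).ennreal_ofReal
  have hφ := (h.measurable_logDensity θ).exp.ennreal_ofReal
  have hT := measurePreserving_scaleMarks σ θ
  rw [levyMeasure_eq_withDensity h.measurable, ← withDensity_mul _ hL hφ]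
  ext B hB
  rw [Measure.map_apply hT.measurable hB, withDensity_apply _ (hT.measurable hB),
    withDensity_apply _ hB, ← hT.setLIntegral_comp_preimage hB (hL.mul hφ)]
  refine lintegral_congr fun p => ?_
  rw [Pi.mul_apply, ← ENNReal.ofReal_mul (zeroExtend_nonneg h.pos_or_zero _),
    h.zeroExtend_mul_exp_logDensity, scaleMarks_inv_scaleMarks]

/-- Gives both the integrability of `e^φ - 1` and the value of the normalizing constant, up to sign,
in terms of `scaleDiff`. -/
theorem zeroExtend_smul_exp_sub_one (h : IsRegularLevyDensity σ l) (θ : currentGroup X)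
    (p : X × ℝ) : (ENNReal.ofReal (zeroExtend l p)).toReal • (Real.exp (logDensity l θ p) - 1) =
      -scaleDiff l θ p := by
  rw [ENNReal.toReal_ofReal (zeroExtend_nonneg h.pos_or_zero _), smul_eq_mul, mul_sub, mul_one,
    h.zeroExtend_mul_exp_logDensity, scaleDiff, neg_sub]

theorem integrable_exp_logDensity_sub_one [SFinite σ] [NullSingletonClass σ]
    (h : IsRegularLevyDensity σ l) (θ : currentGroup X) :
    Integrable (fun p => Real.exp (logDensity l θ p) - 1) (levyMeasure σ l) := by
  rw [levyMeasure_eq_withDensity h.measurable, integrable_withDensity_iff_integrable_smul'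
    (measurable_zeroExtend h.measurable).ennreal_ofReal
    (Eventually.of_forall fun _ => ENNReal.ofReal_lt_top)]
  simp only [h.zeroExtend_smul_exp_sub_one]
  exact (h.integrable_scaleDiff θ).neg

theorem integral_exp_logDensity_sub_one [SFinite σ] (h : IsRegularLevyDensity σ l)
    (θ : currentGroup X) : ∫ p, (Real.exp (logDensity l θ p) - 1) ∂levyMeasure σ l =
      -∫ p, scaleDiff l θ p ∂σ.prod scaleInvariant := by
  rw [levyMeasure_eq_withDensity h.measurable, integral_withDensity_eq_integral_toReal_smul
    (measurable_zeroExtend h.measurable).ennreal_ofReal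
    (Eventually.of_forall fun _ => ENNReal.ofReal_lt_top)]
  simp only [h.zeroExtend_smul_exp_sub_one]
  exact integral_neg _

theorem _root_.inv_smul_scaleDiff (l : X → ℝ → ℝ) (θ : currentGroup X) {p : X × ℝ} (hp : 0 < p.2) :
    (ENNReal.ofReal p.2⁻¹).toReal • scaleDiff l θ p =
      (l p.1 p.2 - l p.1 ((currentVal θ p.1)⁻¹ * p.2)) / p.2 := by
  rw [ENNReal.toReal_ofReal (inv_nonneg.2 hp.le), smul_eq_mul, scaleDiff_of_pos l θ hp,
    div_eq_inv_mul]

theorem integrable_inv_smul_scaleDiff [SFinite σ] [NullSingletonClass σ]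
    (h : IsRegularLevyDensity σ l) (θ : currentGroup X) :
    Integrable (fun p : X × ℝ => (ENNReal.ofReal p.2⁻¹).toReal • scaleDiff l θ p)
      (σ.prod (volume.restrict (Ioi 0))) := by
  have h1 := h.integrable_scaleDiff θ
  have hm : Measurable fun p : X × ℝ => ENNReal.ofReal p.2⁻¹ := measurable_snd.inv.ennreal_ofReal
  rwa [prod_scaleInvariant, integrable_withDensity_iff_integrable_smul' hm
    (Eventually.of_forall fun _ => ENNReal.ofReal_lt_top)] at h1

theorem integrableOn_sub_div [SFinite σ] [NullSingletonClass σ] (h : IsRegularLevyDensity σ l)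
    (θ : currentGroup X) :
    IntegrableOn (fun p : X × ℝ => (l p.1 p.2 - l p.1 ((currentVal θ p.1)⁻¹ * p.2)) / p.2)
      (positivitySet l ×ˢ Ioi 0) (σ.prod volume) := by
  have hY := measurableSet_positivitySet h.measurable h.pos_or_zero
  have h1 := (h.integrable_inv_smul_scaleDiff θ).integrableOn (s := positivitySet l ×ˢ univ)
  rw [IntegrableOn, ← Measure.prod_restrict, Measure.restrict_univ, Measure.prod_restrict] at h1
  exact IntegrableOn.congr_fun h1 (fun p hp => inv_smul_scaleDiff l θ hp.2)
    (hY.prod measurableSet_Ioi)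

theorem integral_scaleDiff [SFinite σ] [NullSingletonClass σ] (h : IsRegularLevyDensity σ l)
    (θ : currentGroup X) : ∫ p, scaleDiff l θ p ∂σ.prod scaleInvariant =
      ∫ x in positivitySet l, (∫ s in Ioi (0 : ℝ),
        (l x s - l x ((currentVal θ x)⁻¹ * s)) / s) ∂σ := by
  have hY := measurableSet_positivitySet h.measurable h.pos_or_zero
  have hm : Measurable fun p : X × ℝ => ENNReal.ofReal p.2⁻¹ := measurable_snd.inv.ennreal_ofReal
  rw [prod_scaleInvariant, integral_withDensity_eq_integral_toReal_smul hm
    (Eventually.of_forall fun _ => ENNReal.ofReal_lt_top),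
    integral_prod _ (h.integrable_inv_smul_scaleDiff θ)]
  rw [← setIntegral_eq_integral_of_forall_compl_eq_zero (s := positivitySet l) fun x hx => ?_]
  · refine setIntegral_congr_fun hY fun x _ => ?_
    exact setIntegral_congr_fun measurableSet_Ioi fun s hs =>
      inv_smul_scaleDiff l θ (p := (x, s)) hs
  · refine integral_eq_zero_of_ae (Eventually.of_forall fun s => ?_)
    change _ • scaleDiff l θ (x, s) = (0 : ℝ)
    rw [h.scaleDiff_of_notMem θ (p := (x, s)) hx, smul_zero]

theorem _root_.logRatio_eq (l : X → ℝ → ℝ) (θ : currentGroup X) (η : RadonMeasure X)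
    (x : X) : logRatio l θ η x = (η.weight x)⁻¹ * logDensity l θ (x, η.weight x) := by
  have h0 : 0 ≤ η.weight x := ENNReal.toReal_nonneg
  rcases h0.eq_or_lt with h1 | h1
  -- Where `η` has no atom, both sides vanish because `0⁻¹ = 0`.
  · rw [logRatio, ← h1, inv_zero, mul_zero, zero_mul]
  · have h2 : logDensity l θ (x, η.weight x) =
        Real.log (l x ((currentVal θ x)⁻¹ * η.weight x) / l x (η.weight x)) := by
      rw [logDensity, zeroExtend_of_pos l h1, scaleMarks_inv_apply,
        zeroExtend_of_pos l (mul_pos (inv_pos.2 (RadonMeasure.currentVal_pos θ x)) h1)]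
    rw [h2, logRatio, mul_comm]

/-- Off the positivity set the quotient is a division by zero and its logarithm is `0`, so
restricting the integral changes nothing. -/
theorem setIntegral_logRatio (h : IsRegularLevyDensity σ l) (θ : currentGroup X)
    (η : RadonMeasure X) : ∫ x in positivitySet l, logRatio l θ η x ∂η.1 =
      ∫ x, (η.weight x)⁻¹ * logDensity l θ (x, η.weight x) ∂η.1 := by
  rw [setIntegral_eq_integral_of_forall_compl_eq_zero fun x hx => ?_]
  · exact integral_congr_ae (Eventually.of_forall fun x => logRatio_eq l θ η x)
  · rw [logRatio_eq, logDensity, zeroExtend_of_notMem (p := (x, η.weight x)) h.pos_or_zero hx,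
      div_zero, Real.log_zero, mul_zero]

end IsRegularLevyDensity

end

/-! ### The main theorem. -/

theorem theorem3p1 {X : Type*} [TopologicalSpace X] [LocallyCompactSpace X] [PolishSpace X]
    [MeasurableSpace X] [BorelSpace X]
    (σ : Measure X) [IsFiniteMeasureOnCompacts σ] [NullSingletonClass σ]
    (l : X → ℝ → ℝ)
    (l_measurable : Measurable fun p : X × Ioi (0 : ℝ) => l p.1 p.2)
    (l_pos_or_zero : ∀ x, (∀ s, 0 < s → 0 < l x s) ∨ (∀ s, 0 < s → l x s = 0))
    (l_integrable : ∀ A ⊆ positivitySet l, IsBoundedBorel A →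
      ∫⁻ p in A ×ˢ Ioi (0 : ℝ), ENNReal.ofReal (l p.1 p.2 * min p.2⁻¹ 1) ∂(σ.prod volume) < ∞)
    (l_regular : ∀ n : ℕ, 1 ≤ n → ∃ ε : ℝ, 0 < ε ∧
      ∀ A ⊆ positivitySet l, IsBoundedBorel A →
        ∫⁻ x in A, (⨆ r ∈ Icc (1 / (n : ℝ)) (n : ℝ),
          ∫⁻ s in Ioo 0 ε, ENNReal.ofReal (|l x (r * s) - l x s| / s)) ∂σ < ∞) :
    (∃! μ : Measure (RadonMeasure X), HasLevyMeasure (levyMeasure σ l) μ) ∧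
    ∀ μ : Measure (RadonMeasure X), HasLevyMeasure (levyMeasure σ l) μ →
      (∀ θ : currentGroup X, MapsTo (fun η : RadonMeasure X => θ • η)
        (discreteRadon X) (discreteRadon X)) ∧
      QuasiInvariant (currentGroup X) μ ∧
      ∀ θ : currentGroup X,
        (∀ᵐ η ∂μ, IntegrableOn (logRatio l θ η) (positivitySet l) η.1) ∧
        IntegrableOn (fun p : X × ℝ => (l p.1 p.2 - l p.1 ((currentVal θ p.1)⁻¹ * p.2)) / p.2)
          (positivitySet l ×ˢ Ioi 0) (σ.prod volume) ∧
        (μ.map fun η => θ • η).rnDeriv μ =ᵐ[μ] fun η => ENNReal.ofReal (Real.exp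
          ((∫ x in positivitySet l, logRatio l θ η x ∂η.1) +
            ∫ x in positivitySet l, (∫ s in Ioi (0 : ℝ),
              (l x s - l x ((currentVal θ x)⁻¹ * s)) / s) ∂σ)) := by
  have : IsLocallyFiniteMeasure σ := isLocallyFiniteMeasure_of_isFiniteMeasureOnCompacts
  have : SFinite σ := inferInstance
  have h : IsRegularLevyDensity σ l := ⟨l_measurable, l_pos_or_zero, l_integrable, l_regular⟩
  have hM : IsLevyIntensity (levyMeasure σ l) := h.isLevyIntensity
  have hsf : SFinite (levyMeasure σ l) := by unfold levyMeasure; infer_instance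
  obtain ⟨ν, hν⟩ := hM.exists_hasPoissonMarks
  have hνL := hν.hasLevyMeasure hM
  refine ⟨⟨ν, hνL, fun μ hμ => hμ.unique hνL⟩, fun μ hμL => ?_⟩
  -- Uniqueness gives an arbitrary `μ` the exponential formula for sums over atoms, which its
  -- definition does not contain.
  obtain rfl : μ = ν := hμL.unique hνL
  have := hν.isProbabilityMeasure
  have hmap : ∀ θ : currentGroup X, μ.map (fun η => θ • η) = μ.withDensity fun η =>
      ENNReal.ofReal (Real.exp ((∫ x in positivitySet l, logRatio l θ η x ∂η.1) +
        ∫ x in positivitySet l, (∫ s in Ioi (0 : ℝ),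
          (l x s - l x ((currentVal θ x)⁻¹ * s)) / s) ∂σ)) := fun θ => by
    refine (hν.map_smul_eq_withDensity hM θ (h.measurable_logDensity θ)
      (h.integrable_exp_logDensity_sub_one θ) (h.map_scaleMarks_levyMeasure θ)).trans ?_
    refine congrArg _ (funext fun η => ?_)
    rw [h.integral_exp_logDensity_sub_one, h.integral_scaleDiff, sub_neg_eq_add]
    exact congrArg (fun t => ENNReal.ofReal (Real.exp (t + _))) (h.setIntegral_logRatio θ η).symm
  have hmeas : ∀ θ : currentGroup X, Measurable fun η : RadonMeasure X =>
      ENNReal.ofReal (Real.exp ((∫ x in positivitySet l, logRatio l θ η x ∂η.1) +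
        ∫ x in positivitySet l, (∫ s in Ioi (0 : ℝ),
          (l x s - l x ((currentVal θ x)⁻¹ * s)) / s) ∂σ)) := fun θ => by
    have h1 := (RadonMeasure.measurable_integral_marked
      (Complex.measurable_ofReal.comp (h.measurable_logDensity θ))).re
    have h2 : (fun η : RadonMeasure X => ∫ x in positivitySet l, logRatio l θ η x ∂η.1) =
        fun η : RadonMeasure X => RCLike.re (∫ x, RadonMeasure.marked
          (fun p => (logDensity l θ p : ℂ)) η x ∂η.1) := funext fun η => by
      refine (h.setIntegral_logRatio θ η).trans ?_
      refine Eq.trans ?_ (congrArg RCLike.re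
        (RadonMeasure.integral_marked_ofReal (logDensity l θ) η)).symm
      exact (Complex.ofReal_re _).symm
    have h3 : Measurable fun η : RadonMeasure X =>
      ∫ x in positivitySet l, logRatio l θ η x ∂η.1 := h2 ▸ h1
    exact (h3.add_const _).exp.ennreal_ofReal
  refine ⟨RadonMeasure.mapsTo_smul_discreteRadon, fun θ => ?_, fun θ => ⟨?_, ?_, ?_⟩⟩
  · rw [hmap θ]
    -- The converse absolute continuity holds because an exponential density never vanishes.
    exact ⟨withDensity_absolutelyContinuous _ _, withDensity_absolutelyContinuous'
      (hmeas θ).aemeasurable (Eventually.of_forall fun _ =>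
        (ENNReal.ofReal_pos.2 (Real.exp_pos _)).ne')⟩
  · filter_upwards [hν.ae_integrable_log (h.measurable_logDensity θ)
      (h.integrable_exp_logDensity_sub_one θ)] with η hη
    have h1 : logRatio l θ η = fun x => RCLike.re (RadonMeasure.marked
        (fun p => (logDensity l θ p : ℂ)) η x) := funext fun x => by
      rw [logRatio_eq]
      simp [RadonMeasure.marked]
    rw [h1]
    exact hη.re.integrableOn
  · exact h.integrableOn_sub_div θ
  · rw [hmap θ]
    exact Measure.rnDeriv_withDensity μ (hmeas θ)
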